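/- Let $n\ge 2$ and let $\mathbb S^n_1=\{x\in\mathbb R^{n+1}:|x|=\sqrt{n-1}\}$ be the Euclidean sphere of radius $\sqrt{n-1}$, with its induced Riemannian metric, its uniform (normalized surface) probability measure $\mu$, gradient $\nabla$, Hessian $\nabla^2$ and Laplace–Beltrami operator $\Delta=\operatorname{tr}\nabla^2$. Put $\Gamma_0(f,g)=fg$ and $$\Gamma_{k+1}(f,g)=\tfrac12\bigl(\Delta\Gamma_k(f,g)-\Gamma_k(f,\Delta g)-\Gamma_k(g,\Delta f)\bigr),$$ and write $\Gamma(f)=\Gamma_1(f,f)$, $\Gamma_2(f)=\Gamma_2(f,f)$. Let $\Pi_1$ be the orthogonal projection in $L^2(\mu)$ onto the span of the $n+1$ coordinate functions, and let $\|\cdot\|_2$ be the norm of $L^2(\mu)$. (i) For every $f:\mathbb S^n_1\to\mathbb R$ of class $C^4$ (the regularity for which $\Gamma_2(f)$ is defined pointwise by the formula above) with $\int f\,d\mu=0$, $$\int(\Gamma_2(f)-\Gamma(f))\,d\mu=\int\|\nabla^2f\|_{HS}^2\,d\mu\;\ge\;\tfrac12\|f+\Delta f\|_2^2\;\ge\;\tfrac12\|f-\Pi_1f\|_2^2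 ,$$ where both integrands on the left are integrable and $f+\Delta f$, $f-\Pi_1 f$ belong to $L^2(\mu)$. (ii) The same holds for every $f$ in the domain $H^2(\mathbb S^n_1)$ of $\Delta$ (the completion of $C^\infty(\mathbb S^n_1)$ in the norm $\|f\|_2+\|\nabla f\|_2+\|\nabla^2f\|_2$) with $\int f\,d\mu=0$, where $\nabla f$, $\nabla^2 f$ are the $L^2$ limits of the gradients and Hessians of approximating smooth functions, $\Delta f=\operatorname{tr}\nabla^2 f$, and the first integral is read as $\int\bigl((\Delta f)^2-|\nabla f|^2\bigr)\,d\mu$. -/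

import Mathlib

namespace SpherePoincare

/-- The ambient Euclidean space `ℝ^(n+1)`. -/
abbrev Amb (n : ℕ) : Type := EuclideanSpace ℝ (Fin (n + 1))

/-- The radius `√(n-1)`, for which the `n`-dimensional sphere has Ricci curvature `1`. -/
noncomputable def radius (n : ℕ) : ℝ := Real.sqrt ((n : ℝ) - 1)

/-- The `n`-dimensional Euclidean sphere of radius `√(n-1)`. -/
abbrev Sph (n : ℕ) : Type := Metric.sphere (0 : Amb n) (radius n)

/-- Dilation of the unit sphere onto the sphere of radius `√(n-1)`. -/
noncomputable def dilate (n : ℕ) (x : Metric.sphere (0 : Amb n) 1) : Sph n :=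
  ⟨radius n • (x : Amb n), by
    have h : ‖(x : Amb n)‖ = 1 := by simp
    simp [norm_smul, h, radius, Real.sqrt_nonneg]⟩

theorem continuous_dilate (n : ℕ) : Continuous (dilate n) :=
  (continuous_subtype_val.const_smul (radius n)).subtype_mk _

/-- The uniform (normalized surface) probability measure on the sphere: the surface measure of
the unit sphere, normalized and carried over by the dilation. -/
noncomputable def unif (n : ℕ) : MeasureTheory.Measure (Sph n) :=
  ((MeasureTheory.volume : MeasureTheory.Measure (Amb n)).toSphere Set.univ)⁻¹ •
    (MeasureTheory.volume : MeasureTheory.Measure (Amb n)).toSphere.map (dilate n)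

instance instIsProbabilityMeasureUnif (n : ℕ) :
    MeasureTheory.IsProbabilityMeasure (unif n) := by
  constructor
  have h0 : (MeasureTheory.volume : MeasureTheory.Measure (Amb n)).toSphere Set.univ ≠ 0 := by
    rw [MeasureTheory.Measure.toSphere_apply_univ]
    refine mul_ne_zero (by simp) ?_
    exact (Metric.measure_ball_pos _ _ one_pos).ne'
  rw [unif, MeasureTheory.Measure.smul_apply,
    MeasureTheory.Measure.map_apply (continuous_dilate n).measurable MeasurableSet.univ,
    Set.preimage_univ, smul_eq_mul]
  exact ENNReal.inv_mul_cancel h0 (MeasureTheory.measure_ne_top _ _)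

/-- `f` is of class `C^k` on the sphere: it is the restriction of a `C^k` function defined on an
open neighbourhood of the sphere. -/
def IsCk {n : ℕ} (k : WithTop ℕ∞) (f : Sph n → ℝ) : Prop :=
  ∃ (U : Set (Amb n)) (F : Amb n → ℝ), IsOpen U ∧ Metric.sphere (0 : Amb n) (radius n) ⊆ U ∧
    ContDiffOn ℝ k F U ∧ ∀ x : Sph n, F x = f x

/-- The extension of a function on the sphere that is constant along rays,
`x ↦ f (√(n-1) x / |x|)` (with value `0` at the origin). -/
noncomputable def radialExt {n : ℕ} {F : Type*} [Zero F] (f : Sph n → F) (x : Amb n) : F :=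
  open Classical in
  if h : (radius n / ‖x‖) • x ∈ Metric.sphere (0 : Amb n) (radius n) then f ⟨_, h⟩ else 0

/-- Orthogonal projection of the ambient space onto the tangent space `x^⊥` of the sphere
at `x`. -/
noncomputable def tangentProj {n : ℕ} (x : Sph n) : Amb n →L[ℝ] Amb n :=
  (Submodule.span ℝ {(x : Amb n)})ᗮ.starProjection

/-- The Riemannian gradient `∇f` on the sphere, as an ambient vector: the tangential part of the
Euclidean gradient of an extension of `f`. -/
noncomputable def grad {n : ℕ} (f : Sph n → ℝ) (x : Sph n) : Amb n :=
  tangentProj x (gradient (radialExt f) (x : Amb n))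

/-- The Riemannian Hessian `∇²f` at `x`, as the endomorphism `v ↦ ∇_v (∇f)` of the tangent space,
extended by `0` to the normal direction. The Levi-Civita derivative of a tangent field on the
sphere is the tangential part of its ambient derivative. -/
noncomputable def hess {n : ℕ} (f : Sph n → ℝ) (x : Sph n) : Amb n →L[ℝ] Amb n :=
  tangentProj x ∘L fderiv ℝ (radialExt (grad f)) (x : Amb n) ∘L tangentProj x

/-- Trace of an endomorphism of the ambient space. -/
noncomputable def tr {n : ℕ} (A : Amb n →L[ℝ] Amb n) : ℝ :=
  LinearMap.trace ℝ (Amb n) (A : Amb n →ₗ[ℝ] Amb n)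

/-- Squared Hilbert-Schmidt norm of an endomorphism of the ambient space. For an endomorphism of
the tangent space extended by `0` this is its Hilbert-Schmidt norm on the tangent space. -/
noncomputable def hsSq {n : ℕ} (A : Amb n →L[ℝ] Amb n) : ℝ :=
  ∑ i : Fin (n + 1), ‖A (EuclideanSpace.single i (1 : ℝ))‖ ^ 2

/-- The Laplace-Beltrami operator of the sphere, the trace of the Hessian. -/
noncomputable def lap {n : ℕ} (f : Sph n → ℝ) (x : Sph n) : ℝ := tr (hess f x)

/-- The iterated carré du champ operators of the Laplace-Beltrami operator:
`Γ_0 (f, g) = f g` and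
`Γ_{k+1} (f, g) = 1/2 (Δ Γ_k (f, g) - Γ_k (f, Δ g) - Γ_k (g, Δ f))`. -/
noncomputable def Gam {n : ℕ} : ℕ → (Sph n → ℝ) → (Sph n → ℝ) → Sph n → ℝ
  | 0, f, g => fun x => f x * g x
  | k + 1, f, g => fun x =>
      (1 / 2) * (lap (Gam k f g) x - Gam k f (lap g) x - Gam k g (lap f) x)

/-- The linear map that sends `a` to the class of the linear function `x ↦ ⟨a, x⟩` in
`L²` of the sphere. Its range is the span of the coordinate functions. -/
noncomputable def linFun (n : ℕ) : Amb n →ₗ[ℝ] MeasureTheory.Lp ℝ 2 (unif n) :=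
  (ContinuousMap.toLp (E := ℝ) 2 (unif n) ℝ : C(Sph n, ℝ) →ₗ[ℝ] _) ∘ₗ
    { toFun := fun a => ⟨fun x => inner ℝ a (x : Amb n), by fun_prop⟩
      map_add' := fun a b => by ext x; simp [inner_add_left]
      map_smul' := fun c a => by ext x; simp [inner_smul_left] }

/-- `Π₁ f`, the orthogonal projection in `L²` of a square integrable function `f` onto the linear
functions. -/
noncomputable def proj1 {n : ℕ} (f : Sph n → ℝ) : Sph n → ℝ :=
  open Classical in
  if h : MeasureTheory.MemLp f 2 (unif n) then
    (((LinearMap.range (linFun n)).starProjection (h.toLp f) :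
      MeasureTheory.Lp ℝ 2 (unif n)) : Sph n → ℝ)
  else 0

/-- `f` belongs to the Sobolev space `H²` of the sphere (the completion of the smooth functions
in the norm `‖f‖₂ + ‖∇f‖₂ + ‖∇²f‖₂`), with gradient `X` and Hessian `H`. -/
def IsH2 {n : ℕ} (f : Sph n → ℝ) (X : Sph n → Amb n) (H : Sph n → Amb n →L[ℝ] Amb n) : Prop :=
  MeasureTheory.MemLp f 2 (unif n) ∧ MeasureTheory.MemLp X 2 (unif n) ∧
    MeasureTheory.MemLp H 2 (unif n) ∧
    ∃ u : ℕ → Sph n → ℝ, (∀ j, IsCk ((⊤ : ℕ∞) : WithTop ℕ∞) (u j)) ∧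
      Filter.Tendsto (fun j => MeasureTheory.eLpNorm (fun x => u j x - f x) 2 (unif n))
        Filter.atTop (nhds 0) ∧
      Filter.Tendsto (fun j => MeasureTheory.eLpNorm (fun x => grad (u j) x - X x) 2 (unif n))
        Filter.atTop (nhds 0) ∧
      Filter.Tendsto (fun j => MeasureTheory.eLpNorm (fun x => hess (u j) x - H x) 2 (unif n))
        Filter.atTop (nhds 0)

end SpherePoincare

open MeasureTheory SpherePoincare

namespace SpherePoincare

open scoped RealInnerProductSpace Pointwise

/-! Write `A = ‖Δf‖²`, `B = ⟪f, Δf⟫`, with norms and inner products in `L²`. The radius is chosen so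
that the Ricci curvature is 1, and the integrated Bochner formula then reads `∫ ‖∇²f‖² = A + B`.
Integrating the definitions of `Γ₁` and `Γ₂` gives `-B` and `A`, hence the equality. Since `‖f +
Δf‖² = ‖f‖² + 2B + A`, the first inequality is equivalent to `‖f‖ ≤ ‖Δf‖`. The second is `‖f - Π₁f‖
≤ ‖f + Δf‖`. Both follow from the spectrum of `-Δ`: the eigenvalue `eigval n k` is at least 1 for `k
≥ 1` and at least 2 for `k ≥ 2`, so on degrees `k ≥ 2` the operator `1 + Δ` multiplies by a number
of absolute value at least 1.

The calculus is Euclidean. A function on the sphere is extended to be constant along rays; its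
gradient, Hessian and Laplacian become expressions in partial derivatives of the extension,
simplified by the Euler relation (`hess_single_apply`, `lap_eq_euclLap`, `hsSq_hess`). Integration
by parts comes from rotation invariance of the measure: derivatives along Killing fields have mean
zero (`integral_fderiv_skew`), and summing over coordinate rotations gives `integral_divergence`,
whence Green, energy and Bochner identities.

The spectral part (`IsWeakLap.increment_eq`) needs only a weak Laplacian tested against powers of
linear functions, whose span is dense in `L²`. Weak Laplacians survive `L²` limits, so
`poincare_of_isWeakLap` serves both the `C⁴` and the `H²` statement. -/

theorem radius_pos {n : ℕ} (hn : 2 ≤ n) : 0 < radius n := by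
  have : (2 : ℝ) ≤ n := by exact_mod_cast hn
  exact Real.sqrt_pos.2 (by linarith)

theorem radius_sq {n : ℕ} (hn : 2 ≤ n) : radius n ^ 2 = (n : ℝ) - 1 := by
  have : (2 : ℝ) ≤ n := by exact_mod_cast hn
  exact Real.sq_sqrt (by linarith)

theorem sub_one_ne_zero {n : ℕ} (hn : 2 ≤ n) : (n : ℝ) - 1 ≠ 0 := by
  rw [← radius_sq hn]; exact pow_ne_zero _ (radius_pos hn).ne'

theorem norm_coe {n : ℕ} (x : Sph n) : ‖(x : Amb n)‖ = radius n := by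
  simp

theorem coe_ne_zero {n : ℕ} (hn : 2 ≤ n) (x : Sph n) : (x : Amb n) ≠ 0 := by
  rw [← norm_pos_iff, norm_coe]
  exact radius_pos hn

/-! ### Rotation invariance of the measure and Killing fields -/

/-- A linear isometry acting on a sphere centred at the origin. -/
noncomputable def sphereHomeo {n : ℕ} (e : Amb n ≃ₗᵢ[ℝ] Amb n) (r : ℝ) :
    Metric.sphere (0 : Amb n) r ≃ₜ Metric.sphere (0 : Amb n) r where
  toFun x := ⟨e x, by simp⟩
  invFun x := ⟨e.symm x, by simp⟩
  left_inv x := by ext1; simp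
  right_inv x := by ext1; simp
  continuous_toFun := by fun_prop
  continuous_invFun := by fun_prop

/-- `toSphere` measures a set by the volume of the cone over it; a linear isometry preserves volume
and carries cones to cones. -/
theorem map_toSphere_sphereHomeo {n : ℕ} (e : Amb n ≃ₗᵢ[ℝ] Amb n) :
    (volume : Measure (Amb n)).toSphere.map (sphereHomeo e 1) =
      (volume : Measure (Amb n)).toSphere := by
  ext s hs
  rw [Measure.map_apply (sphereHomeo e 1).continuous.measurable hs,
    Measure.toSphere_apply' _ hs,
    Measure.toSphere_apply' _ ((sphereHomeo e 1).continuous.measurable hs)]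
  congr 1
  rw [← e.measurePreserving.measure_preimage_equiv (f := e.toHomeomorph.toMeasurableEquiv)
    (Set.Ioo (0 : ℝ) 1 • (Subtype.val '' s))]
  congr 1
  ext x
  simp only [Set.mem_smul, Set.mem_image, Set.mem_preimage]
  constructor
  · rintro ⟨r, hr, _, ⟨y, hy, rfl⟩, rfl⟩
    exact ⟨r, hr, _, ⟨_, hy, rfl⟩, by simp [sphereHomeo]⟩
  · rintro ⟨r, hr, _, ⟨y, hy, rfl⟩, h⟩
    refine ⟨r, hr, _, ⟨(sphereHomeo e 1).symm y, by simpa using hy, rfl⟩, ?_⟩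
    apply e.injective
    simpa [sphereHomeo] using h

theorem map_unif_sphereHomeo {n : ℕ} (e : Amb n ≃ₗᵢ[ℝ] Amb n) :
    (unif n).map (sphereHomeo e (radius n)) = unif n := by
  have hd := (continuous_dilate n).measurable
  have h1 := (sphereHomeo e (radius n)).continuous.measurable
  have h2 := (sphereHomeo e 1).continuous.measurable
  have hc : sphereHomeo e (radius n) ∘ dilate n = dilate n ∘ sphereHomeo e 1 := by
    ext1 x
    apply Subtype.ext
    simp [sphereHomeo, dilate]
  rw [unif, Measure.map_smul, Measure.map_map h1 hd, hc, ← Measure.map_map hd h2,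
    map_toSphere_sphereHomeo]

theorem integral_comp_linearIsometryEquiv {n : ℕ} (e : Amb n ≃ₗᵢ[ℝ] Amb n) (G : Amb n → ℝ) :
    ∫ x : Sph n, G (e x) ∂(unif n) = ∫ x : Sph n, G x ∂(unif n) := by
  conv_rhs => rw [← map_unif_sphereHomeo e]
  exact (integral_map_equiv (sphereHomeo e (radius n)).toMeasurableEquiv
    (fun x : Sph n => G x)).symm

theorem integrable_of_continuous {n : ℕ} {E : Type*} [NormedAddCommGroup E] {g : Sph n → E}
    [SecondCountableTopologyEither (Sph n) E] (hg : Continuous g) : Integrable g (unif n) :=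
  hg.integrable_of_hasCompactSupport (HasCompactSupport.of_compactSpace g)

theorem continuous_comp_coe {n : ℕ} (hn : 2 ≤ n) {E : Type*} [TopologicalSpace E] {G : Amb n → E}
    (hG : ContinuousOn G {0}ᶜ) : Continuous fun x : Sph n => G x :=
  hG.comp_continuous continuous_subtype_val fun x => coe_ne_zero hn x

/-- The derivative of a `C¹` function along the Killing field of a skew-adjoint map has mean
zero on the sphere. -/
theorem integral_fderiv_skew {n : ℕ} (hn : 2 ≤ n) {g : Amb n → ℝ}
    (hg : ContDiffOn ℝ 1 g {0}ᶜ) {A : Amb n →L[ℝ] Amb n}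
    (hA : A ∈ skewAdjoint (Amb n →L[ℝ] Amb n)) :
    ∫ x : Sph n, fderiv ℝ g x (A x) ∂(unif n) = 0 := by
  have hu : ∀ t : ℝ, NormedSpace.exp (t • A) ∈ unitary (Amb n →L[ℝ] Amb n) := fun t =>
    letI := NormedAlgebra.restrictScalars ℚ ℝ (Amb n →L[ℝ] Amb n)
    NormedSpace.exp_mem_unitary_of_mem_skewAdjoint (skewAdjoint.smul_mem t hA)
  -- The flow of the Killing field: a one-parameter group of rotations.
  set e : ℝ → Amb n ≃ₗᵢ[ℝ] Amb n := fun t => Unitary.linearIsometryEquiv ⟨_, hu t⟩ with he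
  have hev : ∀ t x, NormedSpace.exp (t • A) x = e t x := fun t x => rfl
  have hopen : IsOpen ({0}ᶜ : Set (Amb n)) := isOpen_compl_singleton
  have hcont : ContinuousOn (fun x => fderiv ℝ g x (A x)) {0}ᶜ :=
    (hg.continuousOn_fderiv_of_isOpen hopen le_rfl).clm_apply A.continuous.continuousOn
  have hne : ∀ t (x : Sph n), e t x ∈ ({0}ᶜ : Set (Amb n)) := fun t x => by
    simpa using coe_ne_zero hn x
  obtain ⟨C, hC⟩ := (isCompact_sphere (0 : Amb n) (radius n)).exists_bound_of_continuousOn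
    (hcont.mono fun x hx => coe_ne_zero hn ⟨x, hx⟩)
  -- Differentiate the mean of `g ∘ e t` at `t = 0` under the integral sign; invariance makes this
  -- mean constant in `t`. The flow stays on the compact sphere, so a constant bounds the
  -- derivative.
  have hder := hasDerivAt_integral_of_dominated_loc_of_deriv_le (μ := unif n)
    (F := fun t (x : Sph n) => g (e t x))
    (F' := fun t (x : Sph n) => fderiv ℝ g (e t x) (A (e t x))) (x₀ := (0 : ℝ))
    (bound := fun _ => C) (s := Set.univ) Filter.univ_mem
    (Filter.Eventually.of_forall fun t => ?_) ?_ ?_ ?_ (integrable_const C) ?_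
  · have h0 := hder.2
    have hconst : (fun t => ∫ x : Sph n, g (e t x) ∂(unif n)) =
        fun _ => ∫ x : Sph n, g x ∂(unif n) := by
      ext t; exact integral_comp_linearIsometryEquiv (e t) g
    rw [hconst] at h0
    have h1 := h0.unique (hasDerivAt_const _ _)
    have h2 : ∀ x, e 0 x = x := fun x => by
      rw [← hev, show (0 : ℝ) • A = 0 from zero_smul ℝ A, NormedSpace.exp_zero]; rfl
    simpa [h2] using h1
  · exact (hg.continuousOn.comp_continuous ((e t).continuous.comp continuous_subtype_val)
      (hne t)).aestronglyMeasurable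
  · exact integrable_of_continuous (hg.continuousOn.comp_continuous
      ((e 0).continuous.comp continuous_subtype_val) (hne 0))
  · exact (hcont.comp_continuous ((e 0).continuous.comp continuous_subtype_val)
      (hne 0)).aestronglyMeasurable
  · exact Filter.Eventually.of_forall fun x t _ => hC _ (by simp)
  · refine Filter.Eventually.of_forall fun x t _ => ?_
    have hd : DifferentiableAt ℝ g (e t x) :=
      (hg.differentiableOn one_ne_zero).differentiableAt (hopen.mem_nhds (hne t x))
    have h1 : HasDerivAt (fun t : ℝ => NormedSpace.exp (t • A) (x : Amb n))
        ((A * NormedSpace.exp (t • A)) (x : Amb n)) t := by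
      have := hasDerivAt_exp_smul_const' (𝕂 := ℝ) A t
      exact ((ContinuousLinearMap.apply ℝ (Amb n) (x : Amb n)).hasFDerivAt.comp_hasDerivAt t this)
    exact hd.hasFDerivAt.comp_hasDerivAt t h1

/-! ### Calculus of functions homogeneous off the origin -/

/-- The `i`-th partial derivative. -/
noncomputable def pd {n : ℕ} (i : Fin (n + 1)) (φ : Amb n → ℝ) (x : Amb n) : ℝ :=
  fderiv ℝ φ x (EuclideanSpace.single i (1 : ℝ))

/-- The Euclidean Laplacian. -/
noncomputable def euclLap {n : ℕ} (φ : Amb n → ℝ) (x : Amb n) : ℝ := ∑ i, pd i (pd i φ) x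

/-- `φ` is of class `C^k` off the origin and satisfies the Euler relation of degree `d` there. -/
structure IsHom {n : ℕ} (d : ℝ) (k : ℕ) (φ : Amb n → ℝ) : Prop where
  smooth : ContDiffOn ℝ k φ {0}ᶜ
  euler : ∀ x, x ≠ 0 → fderiv ℝ φ x x = d * φ x

theorem eq_sum_single {n : ℕ} (x : Amb n) : x = ∑ i, x i • EuclideanSpace.single i (1 : ℝ) := by
  ext j
  simp [Pi.single_apply]

theorem fderiv_apply_eq_sum {n : ℕ} (φ : Amb n → ℝ) (x v : Amb n) :
    fderiv ℝ φ x v = ∑ i, v i * pd i φ x := by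
  conv_lhs => rw [eq_sum_single v]
  simp [pd, map_sum]

theorem pd_mul {n : ℕ} {φ ψ : Amb n → ℝ} {x : Amb n} (hφ : DifferentiableAt ℝ φ x)
    (hψ : DifferentiableAt ℝ ψ x) (i : Fin (n + 1)) :
    pd i (fun y => φ y * ψ y) x = pd i φ x * ψ x + φ x * pd i ψ x := by
  simp only [pd]
  rw [fderiv_fun_mul hφ hψ]
  simp; ring

theorem pd_sub {n : ℕ} {φ ψ : Amb n → ℝ} {x : Amb n} (hφ : DifferentiableAt ℝ φ x)
    (hψ : DifferentiableAt ℝ ψ x) (i : Fin (n + 1)) :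
    pd i (fun y => φ y - ψ y) x = pd i φ x - pd i ψ x := by
  simp only [pd]
  rw [fderiv_fun_sub hφ hψ]
  simp

theorem pd_sum {n : ℕ} {ι : Type*} {s : Finset ι} {φ : ι → Amb n → ℝ} {x : Amb n}
    (hφ : ∀ a ∈ s, DifferentiableAt ℝ (φ a) x) (i : Fin (n + 1)) :
    pd i (fun y => ∑ a ∈ s, φ a y) x = ∑ a ∈ s, pd i (φ a) x := by
  simp only [pd]
  rw [fderiv_fun_sum hφ]
  simp

namespace IsHom

variable {n k l : ℕ} {d e : ℝ} {φ ψ : Amb n → ℝ} {x : Amb n}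

theorem mono (h : IsHom d l φ) (hk : k ≤ l) : IsHom d k φ :=
  ⟨h.smooth.of_le (by exact_mod_cast hk), h.euler⟩

theorem differentiableAt (h : IsHom d k φ) (hk : 1 ≤ k) (hx : x ≠ 0) : DifferentiableAt ℝ φ x :=
  (h.smooth.differentiableOn (by
    exact_mod_cast (Nat.one_le_iff_ne_zero.1 hk))).differentiableAt
    (isOpen_compl_singleton.mem_nhds hx)

theorem contDiffAt (h : IsHom d k φ) (hx : x ≠ 0) : ContDiffAt ℝ k φ x :=
  h.smooth.contDiffAt (isOpen_compl_singleton.mem_nhds hx)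

theorem const (c : ℝ) : IsHom (n := n) 0 k fun _ => c :=
  ⟨contDiffOn_const, fun x _ => by simp⟩

theorem coord (i : Fin (n + 1)) : IsHom (n := n) 1 k fun x => x i :=
  ⟨by fun_prop, fun x _ => by
    have : HasFDerivAt (fun x : Amb n => x i) (EuclideanSpace.proj i : Amb n →L[ℝ] ℝ) x :=
      (EuclideanSpace.proj i : Amb n →L[ℝ] ℝ).hasFDerivAt
    rw [this.fderiv]; simp⟩

theorem mul (hφ : IsHom d k φ) (hψ : IsHom e k ψ) (hk : 1 ≤ k) :
    IsHom (d + e) k fun x => φ x * ψ x :=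
  ⟨hφ.smooth.mul hψ.smooth, fun x hx => by
    rw [fderiv_fun_mul (hφ.differentiableAt hk hx) (hψ.differentiableAt hk hx)]
    simp [hφ.euler x hx, hψ.euler x hx]; ring⟩

theorem sub (hφ : IsHom d k φ) (hψ : IsHom d k ψ) (hk : 1 ≤ k) :
    IsHom d k fun x => φ x - ψ x :=
  ⟨hφ.smooth.sub hψ.smooth, fun x hx => by
    rw [fderiv_fun_sub (hφ.differentiableAt hk hx) (hψ.differentiableAt hk hx)]
    simp [hφ.euler x hx, hψ.euler x hx]; ring⟩

theorem sum {ι : Type*} {s : Finset ι} {φ : ι → Amb n → ℝ} (h : ∀ a ∈ s, IsHom d k (φ a))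
    (hk : 1 ≤ k) : IsHom d k fun x => ∑ a ∈ s, φ a x :=
  ⟨ContDiffOn.sum fun a ha => (h a ha).smooth, fun x hx => by
    rw [fderiv_fun_sum fun a ha => (h a ha).differentiableAt hk hx]
    simp [Finset.mul_sum]
    exact Finset.sum_congr rfl fun a ha => (h a ha).euler x hx⟩

theorem contDiffOn_pd (h : IsHom d l φ) (hk : k + 1 ≤ l) (i : Fin (n + 1)) :
    ContDiffOn ℝ k (SpherePoincare.pd i φ) {0}ᶜ :=
  (h.smooth.fderiv_of_isOpen isOpen_compl_singleton (by exact_mod_cast hk)).clm_apply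
    contDiffOn_const

theorem hasFDerivAt_fderiv (h : IsHom d k φ) (hk : 2 ≤ k) (hx : x ≠ 0) :
    HasFDerivAt (fderiv ℝ φ) (fderiv ℝ (fderiv ℝ φ) x) x := by
  have h1 : ContDiffOn ℝ 1 (fderiv ℝ φ) {0}ᶜ :=
    h.smooth.fderiv_of_isOpen isOpen_compl_singleton (by exact_mod_cast hk)
  exact ((h1.differentiableOn one_ne_zero).differentiableAt
    (isOpen_compl_singleton.mem_nhds hx)).hasFDerivAt

theorem fderiv_pd (h : IsHom d k φ) (hk : 2 ≤ k) (hx : x ≠ 0) (i : Fin (n + 1)) (v : Amb n) :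
    fderiv ℝ (SpherePoincare.pd i φ) x v =
      fderiv ℝ (fderiv ℝ φ) x v (EuclideanSpace.single i (1 : ℝ)) := by
  have := (h.hasFDerivAt_fderiv hk hx).clm_apply
    (hasFDerivAt_const (EuclideanSpace.single i (1 : ℝ)) x)
  unfold SpherePoincare.pd
  rw [this.fderiv]
  simp

theorem symm (h : IsHom d k φ) (hk : 2 ≤ k) (hx : x ≠ 0) (v w : Amb n) :
    fderiv ℝ (fderiv ℝ φ) x v w = fderiv ℝ (fderiv ℝ φ) x w v := by
  have := (h.contDiffAt hx).isSymmSndFDerivAt (by simpa using (by exact_mod_cast hk))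
  exact this v w

theorem pd_comm (h : IsHom d k φ) (hk : 2 ≤ k) (hx : x ≠ 0) (i j : Fin (n + 1)) :
    SpherePoincare.pd i (SpherePoincare.pd j φ) x =
      SpherePoincare.pd j (SpherePoincare.pd i φ) x := by
  rw [SpherePoincare.pd, SpherePoincare.pd, h.fderiv_pd hk hx, h.fderiv_pd hk hx, h.symm hk hx]

/-- Differentiating the Euler relation lowers the degree by one; symmetry of second derivatives puts
the result in Euler form. -/
theorem pd (h : IsHom d l φ) (hk : k + 1 ≤ l) (h1 : 1 ≤ k) (i : Fin (n + 1)) :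
    IsHom (d - 1) k (SpherePoincare.pd i φ) := by
  refine ⟨h.contDiffOn_pd hk i, fun x hx => ?_⟩
  have h2 : 2 ≤ l := by omega
  rw [h.fderiv_pd h2 hx, h.symm h2 hx]
  have e1 : HasFDerivAt (fun y => fderiv ℝ φ y y)
      ((fderiv ℝ φ x).comp (ContinuousLinearMap.id ℝ (Amb n)) +
        (fderiv ℝ (fderiv ℝ φ) x).flip x) x :=
    (h.hasFDerivAt_fderiv h2 hx).clm_apply (hasFDerivAt_id x)
  have e2 : HasFDerivAt (fun y => fderiv ℝ φ y y) (d • fderiv ℝ φ x) x := by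
    refine ((h.differentiableAt (by omega) hx).hasFDerivAt.const_mul d).congr_of_eventuallyEq ?_
    filter_upwards [isOpen_compl_singleton.mem_nhds hx] with y hy using h.euler y hy
  have := congrArg (fun T => T (EuclideanSpace.single i (1 : ℝ))) (e1.unique e2)
  simp at this
  simp only [SpherePoincare.pd]
  linarith

theorem euler_sum (h : IsHom d k φ) (hx : x ≠ 0) :
    ∑ i, x i * SpherePoincare.pd i φ x = d * φ x := by
  rw [← fderiv_apply_eq_sum, h.euler x hx]

theorem continuousOn_pd (h : IsHom d k φ) (hk : 1 ≤ k) (i : Fin (n + 1)) :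
    ContinuousOn (SpherePoincare.pd i φ) {0}ᶜ :=
  (h.contDiffOn_pd (k := 0) (by omega) i).continuousOn

theorem euclLap (h : IsHom d l φ) (hk : k + 2 ≤ l) (h1 : 1 ≤ k) :
    IsHom (d - 2) k (euclLap φ) := by
  have := IsHom.sum (s := Finset.univ) (fun i _ =>
    ((h.pd (k := k + 1) (by omega) (by omega) i).pd le_rfl h1 i)) h1
  rwa [show d - 1 - 1 = d - 2 by ring] at this

theorem contDiffOn_euclLap (h : IsHom d l φ) (hk : k + 2 ≤ l) :
    ContDiffOn ℝ k (SpherePoincare.euclLap φ) {0}ᶜ :=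
  ContDiffOn.sum fun i _ => (h.pd (k := k + 1) (by omega) (by omega) i).contDiffOn_pd le_rfl i

end IsHom

/-! ### Divergence theorem, Green, energy and Bochner identities -/

theorem sum_coord_sq {n : ℕ} (hn : 2 ≤ n) (x : Sph n) :
    ∑ i, (x : Amb n) i ^ 2 = (n : ℝ) - 1 := by
  have h := EuclideanSpace.norm_sq_eq (x : Amb n)
  rw [norm_coe x, radius_sq hn] at h
  simp [h]

theorem continuous_coord {n : ℕ} (i : Fin (n + 1)) :
    Continuous fun x : Sph n => (x : Amb n) i := by fun_prop

theorem rotationField_mem_skewAdjoint {n : ℕ} (i j : Fin (n + 1)) :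
    ((EuclideanSpace.proj i : Amb n →L[ℝ] ℝ).smulRight (EuclideanSpace.single j (1 : ℝ)) -
      (EuclideanSpace.proj j : Amb n →L[ℝ] ℝ).smulRight (EuclideanSpace.single i (1 : ℝ))) ∈
      skewAdjoint (Amb n →L[ℝ] Amb n) := by
  rw [skewAdjoint.mem_iff, ContinuousLinearMap.star_eq_adjoint]
  symm
  rw [ContinuousLinearMap.eq_adjoint_iff]
  intro x y
  simp [inner_sub_left, inner_sub_right, inner_smul_left, inner_smul_right,
    EuclideanSpace.inner_single_left, EuclideanSpace.inner_single_right]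
  ring

/-- The divergence theorem on the sphere, for a homogeneous vector field. -/
theorem integral_divergence {n : ℕ} (hn : 2 ≤ n) {d : ℝ} {V : Fin (n + 1) → Amb n → ℝ}
    (hV : ∀ i, IsHom d 1 (V i)) :
    ∫ x : Sph n, (((n : ℝ) - 1) * ∑ i, pd i (V i) x - (n + d) * ∑ i, (x : Amb n) i * V i x)
      ∂(unif n) = 0 := by
  -- The field `x_i ∂_j - x_j ∂_i` applied to `x_i V_j`. Summed over `i, j`, the `x_i²` give `n -
  -- 1`, the Euler relation gives `d`, and the undifferentiated terms give `1 - (n + 1) = -n`.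
  have key : ∀ i j, ∫ x : Sph n, ((if i = j then (x : Amb n) i * V j x else 0)
      - (x : Amb n) j * V j x + (x : Amb n) i ^ 2 * pd j (V j) x
      - (x : Amb n) j * ((x : Amb n) i * pd i (V j) x)) ∂(unif n) = 0 := by
    intro i j
    have hg : IsHom (1 + d) 1 fun x : Amb n => x i * V j x := (IsHom.coord i).mul (hV j) le_rfl
    refine Eq.trans ?_ (integral_fderiv_skew hn (g := fun x : Amb n => x i * V j x)
      (by exact_mod_cast hg.smooth) (rotationField_mem_skewAdjoint i j))
    refine integral_congr_ae (Filter.Eventually.of_forall fun x => ?_)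
    have hx := coe_ne_zero hn x
    have hc : HasFDerivAt (fun x : Amb n => x i) (EuclideanSpace.proj i : Amb n →L[ℝ] ℝ) x :=
      (EuclideanSpace.proj i : Amb n →L[ℝ] ℝ).hasFDerivAt
    simp only
    rw [(hc.fun_mul ((hV j).differentiableAt le_rfl hx).hasFDerivAt).fderiv]
    simp only [pd, map_sub, sub_apply, ContinuousLinearMap.smulRight_apply,
      map_smul, add_apply, smul_apply, smul_eq_mul]
    by_cases hij : i = j
    · subst hij; simp; ring
    · simp [hij]; ring
  have hc1 : ∀ i j, Continuous fun x : Sph n => pd i (V j) x := fun i j =>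
    continuous_comp_coe hn ((hV j).continuousOn_pd le_rfl i)
  have hc2 : ∀ j, Continuous fun x : Sph n => V j x := fun j =>
    continuous_comp_coe hn (hV j).smooth.continuousOn
  have hsum := Finset.sum_eq_zero fun i (_ : i ∈ Finset.univ) =>
    Finset.sum_eq_zero fun j (_ : j ∈ Finset.univ) => key i j
  have hint : ∀ i j, Integrable (fun x : Sph n => (if i = j then (x : Amb n) i * V j x else 0)
      - (x : Amb n) j * V j x + (x : Amb n) i ^ 2 * pd j (V j) x
      - (x : Amb n) j * ((x : Amb n) i * pd i (V j) x)) (unif n) := by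
    intro i j
    apply integrable_of_continuous
    have h1 := hc1 i j
    have h2 := hc1 j j
    have h3 := hc2 j
    have ci := continuous_coord (n := n) i
    have cj := continuous_coord (n := n) j
    refine ((Continuous.sub ?_ (cj.mul h3)).add ((ci.pow 2).mul h2)).sub (cj.mul (ci.mul h1))
    split_ifs
    exacts [ci.mul h3, continuous_const]
  simp_rw [← integral_finsetSum _ fun j _ => hint _ j] at hsum
  rw [← integral_finsetSum _ fun i _ => integrable_finsetSum _ fun j _ => hint i j] at hsum
  rw [← hsum]
  refine integral_congr_ae (Filter.Eventually.of_forall fun x => ?_)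
  have hx := coe_ne_zero hn x
  simp only [Finset.sum_add_distrib, Finset.sum_sub_distrib, Finset.sum_ite_eq, Finset.mem_univ,
    if_true, Finset.sum_const, Finset.card_univ, Fintype.card_fin]
  have e1 : ∑ i, ∑ j, (x : Amb n) i ^ 2 * pd j (V j) x = ((n : ℝ) - 1) * ∑ j, pd j (V j) x := by
    rw [← sum_coord_sq hn x, Finset.sum_mul_sum]
  have e2 : ∑ i, ∑ j, (x : Amb n) j * ((x : Amb n) i * pd i (V j) x) =
      d * ∑ j, (x : Amb n) j * V j x := by
    rw [Finset.sum_comm, Finset.mul_sum]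
    refine Finset.sum_congr rfl fun j _ => ?_
    rw [← Finset.mul_sum, (hV j).euler_sum hx]; ring
  rw [e1, e2]
  simp
  ring

/-- The eigenvalue `d (d + n - 1) / (n - 1)` of `-Δ` on spherical harmonics of degree `d` on the
sphere of radius `√(n-1)`. -/
noncomputable def eigval (n : ℕ) (d : ℝ) : ℝ := d * (d + n - 1) / ((n : ℝ) - 1)

theorem IsHom.continuous_comp_coe {n k : ℕ} (hn : 2 ≤ n) {d : ℝ} {φ : Amb n → ℝ}
    (h : IsHom d k φ) : Continuous fun x : Sph n => φ x :=
  SpherePoincare.continuous_comp_coe hn h.smooth.continuousOn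

theorem IsHom.continuous_pd {n k : ℕ} (hn : 2 ≤ n) {d : ℝ} {φ : Amb n → ℝ}
    (h : IsHom d k φ) (hk : 1 ≤ k) (i : Fin (n + 1)) :
    Continuous fun x : Sph n => SpherePoincare.pd i φ x :=
  SpherePoincare.continuous_comp_coe hn (h.continuousOn_pd hk i)

theorem IsHom.continuous_pd_pd {n k : ℕ} (hn : 2 ≤ n) {d : ℝ} {φ : Amb n → ℝ}
    (h : IsHom d k φ) (hk : 2 ≤ k) (i j : Fin (n + 1)) :
    Continuous fun x : Sph n => SpherePoincare.pd i (SpherePoincare.pd j φ) x :=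
  (h.pd (k := 1) hk le_rfl j).continuous_pd hn le_rfl i

theorem IsHom.continuous_euclLap {n k : ℕ} (hn : 2 ≤ n) {d : ℝ} {φ : Amb n → ℝ}
    (h : IsHom d k φ) (hk : 2 ≤ k) : Continuous fun x : Sph n => SpherePoincare.euclLap φ x :=
  continuous_finsetSum _ fun i _ => h.continuous_pd_pd hn hk i i

/-- Green's identity on the sphere, for homogeneous functions. -/
theorem integral_green {n : ℕ} (hn : 2 ≤ n) {d e : ℝ} {φ ψ : Amb n → ℝ} (hφ : IsHom d 2 φ)
    (hψ : IsHom e 2 ψ) :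
    ∫ x : Sph n, ψ x * (euclLap φ x - eigval n d * φ x) ∂(unif n) =
      ∫ x : Sph n, φ x * (euclLap ψ x - eigval n e * ψ x) ∂(unif n) := by
  have hn1 := sub_one_ne_zero hn
  have cφ := hφ.continuous_comp_coe hn
  have cψ := hψ.continuous_comp_coe hn
  have lφ := hφ.continuous_euclLap hn le_rfl
  have lψ := hψ.continuous_euclLap hn le_rfl
  -- For `V = ψ∇φ - φ∇ψ` one has `x·V = (d - e)φψ`, and `(n + d + e - 1)(d - e) = d(d + n - 1) - e(e
  -- + n - 1)` is where the two eigenvalues come from.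
  have hV : ∀ i, IsHom (d + e - 1) 1 fun x => ψ x * pd i φ x - φ x * pd i ψ x := fun i => by
    have h1 := (hψ.mono one_le_two).mul (hφ.pd le_rfl le_rfl i) le_rfl
    have h2 := (hφ.mono one_le_two).mul (hψ.pd le_rfl le_rfl i) le_rfl
    rw [show e + (d - 1) = d + e - 1 by ring] at h1
    rw [show d + (e - 1) = d + e - 1 by ring] at h2
    exact h1.sub h2 le_rfl
  have h := integral_divergence hn hV
  rw [← sub_eq_zero, ← integral_sub, ← mul_right_inj' hn1, mul_zero, ← integral_const_mul, ← h]
  · refine integral_congr_ae (Filter.Eventually.of_forall fun x => ?_)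
    have hx := coe_ne_zero hn x
    have dφ := hφ.differentiableAt one_le_two hx
    have dψ := hψ.differentiableAt one_le_two hx
    have dφ' := fun i => (hφ.pd (k := 1) le_rfl le_rfl i).differentiableAt le_rfl hx
    have dψ' := fun i => (hψ.pd (k := 1) le_rfl le_rfl i).differentiableAt le_rfl hx
    have e1 : ∑ i, pd i (fun x => ψ x * pd i φ x - φ x * pd i ψ x) x =
        ψ x * euclLap φ x - φ x * euclLap ψ x := by
      rw [euclLap, euclLap, Finset.mul_sum, Finset.mul_sum, ← Finset.sum_sub_distrib]
      refine Finset.sum_congr rfl fun i _ => ?_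
      rw [pd_sub (dψ.fun_mul (dφ' i)) (dφ.fun_mul (dψ' i)), pd_mul dψ (dφ' i), pd_mul dφ (dψ' i)]
      ring
    have e2 : ∑ i, (x : Amb n) i * (ψ x * pd i φ x - φ x * pd i ψ x) =
        (d - e) * φ x * ψ x := by
      have : ∑ i, (x : Amb n) i * (ψ x * pd i φ x - φ x * pd i ψ x) =
          ψ x * ∑ i, (x : Amb n) i * pd i φ x - φ x * ∑ i, (x : Amb n) i * pd i ψ x := by
        rw [Finset.mul_sum, Finset.mul_sum, ← Finset.sum_sub_distrib]
        exact Finset.sum_congr rfl fun i _ => by ring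
      rw [this, hφ.euler_sum hx, hψ.euler_sum hx]; ring
    simp only [e1, e2, eigval]
    field_simp
    ring
  · exact integrable_of_continuous (cψ.mul (lφ.sub (continuous_const.mul cφ)))
  · exact integrable_of_continuous (cφ.mul (lψ.sub (continuous_const.mul cψ)))

/-- The Dirichlet energy of a function extended to be constant along rays. -/
theorem integral_energy {n : ℕ} (hn : 2 ≤ n) {φ : Amb n → ℝ} (hφ : IsHom 0 2 φ) :
    ∫ x : Sph n, ∑ i, pd i φ x ^ 2 ∂(unif n) = -∫ x : Sph n, φ x * euclLap φ x ∂(unif n) := by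
  have hn1 := sub_one_ne_zero hn
  have cφ := hφ.continuous_comp_coe hn
  have lφ := hφ.continuous_euclLap hn le_rfl
  have hV : ∀ i, IsHom (0 + (0 - 1)) 1 fun x => φ x * pd i φ x := fun i =>
    (hφ.mono one_le_two).mul (hφ.pd le_rfl le_rfl i) le_rfl
  have h := integral_divergence hn hV
  have hc : Continuous fun x : Sph n => ∑ i, pd i φ x ^ 2 :=
    continuous_finsetSum _ fun i _ => (hφ.continuous_pd hn one_le_two i).pow 2
  have hm : Continuous fun x : Sph n => φ x * euclLap φ x := cφ.mul lφ
  rw [← sub_eq_zero, sub_neg_eq_add, ← integral_add (integrable_of_continuous hc)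
    (integrable_of_continuous hm), ← mul_right_inj' hn1, mul_zero,
    ← integral_const_mul, ← h]
  refine integral_congr_ae (Filter.Eventually.of_forall fun x => ?_)
  have hx := coe_ne_zero hn x
  have dφ := hφ.differentiableAt one_le_two hx
  have dφ' := fun i => (hφ.pd (k := 1) le_rfl le_rfl i).differentiableAt le_rfl hx
  have e1 : ∑ i, pd i (fun x => φ x * pd i φ x) x = ∑ i, pd i φ x ^ 2 + φ x * euclLap φ x := by
    rw [euclLap, Finset.mul_sum, ← Finset.sum_add_distrib]
    exact Finset.sum_congr rfl fun i _ => by rw [pd_mul dφ (dφ' i)]; ring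
  have e2 : ∑ i, (x : Amb n) i * (φ x * pd i φ x) = 0 := by
    have : ∑ i, (x : Amb n) i * (φ x * pd i φ x) = φ x * ∑ i, (x : Amb n) i * pd i φ x := by
      rw [Finset.mul_sum]
      exact Finset.sum_congr rfl fun i _ => by ring
    rw [this, hφ.euler_sum hx]; ring
  simp only [e1, e2]
  ring

/-- The integrated Bochner formula, for a function extended to be constant along rays. -/
theorem integral_bochner {n : ℕ} (hn : 2 ≤ n) {φ : Amb n → ℝ} (hφ : IsHom 0 3 φ) :
    ∫ x : Sph n, (∑ i, ∑ a, pd i (pd a φ) x ^ 2 - 2 / ((n : ℝ) - 1) * ∑ i, pd i φ x ^ 2)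
      ∂(unif n) =
      ∫ x : Sph n, euclLap φ x ^ 2 ∂(unif n) + ∫ x : Sph n, φ x * euclLap φ x ∂(unif n) := by
  have hn1 := sub_one_ne_zero hn
  have lφ := hφ.continuous_euclLap hn (by norm_num)
  have hh : ∀ a, IsHom (0 - 1) 2 (pd a φ) := fun a => hφ.pd le_rfl one_le_two a
  have hhh : ∀ i a, IsHom (0 - 1 - 1) 1 (pd i (pd a φ)) := fun i a => (hh a).pd le_rfl le_rfl i
  have hL : IsHom (0 - 2) 1 (euclLap φ) := hφ.euclLap le_rfl le_rfl
  -- The field `D²φ ∇φ - (Δφ)∇φ`: in its divergence the third derivatives cancel, leaving `|D²φ|² -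
  -- (Δφ)²`. Its radial part is `-|∇φ|²`, because the first derivatives have degree `-1`.
  have hV : ∀ i, IsHom (-3) 1 fun x => ∑ a, pd a φ x * pd a (pd i φ) x - pd i φ x * euclLap φ x :=
    fun i => by
      have h1 : IsHom (-3) 1 fun x => ∑ a, pd a φ x * pd a (pd i φ) x :=
        IsHom.sum (fun a _ => by
          have := ((hh a).mono one_le_two).mul (hhh a i) le_rfl
          rwa [show (0 - 1 + (0 - 1 - 1) : ℝ) = -3 by norm_num] at this) le_rfl
      have h2 := ((hh i).mono one_le_two).mul hL le_rfl
      rw [show (0 - 1 + (0 - 2) : ℝ) = -3 by norm_num] at h2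
      exact h1.sub h2 le_rfl
  have h := integral_divergence hn hV
  have hc1 : Continuous fun x : Sph n => ∑ i, pd i φ x ^ 2 :=
    continuous_finsetSum _ fun i _ => (hφ.continuous_pd hn (by norm_num) i).pow 2
  have hc2 : Continuous fun x : Sph n => ∑ i, ∑ a, pd i (pd a φ) x ^ 2 :=
    continuous_finsetSum _ fun i _ => continuous_finsetSum _ fun a _ =>
      (hφ.continuous_pd_pd hn (by norm_num) i a).pow 2
  have hE := integral_energy hn (hφ.mono (by norm_num))
  have key : ∫ x : Sph n, (((n : ℝ) - 1) * (∑ i, ∑ a, pd i (pd a φ) x ^ 2 - euclLap φ x ^ 2) +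
      ((n : ℝ) - 3) * ∑ i, pd i φ x ^ 2) ∂(unif n) = 0 := by
    rw [← h]
    refine integral_congr_ae (Filter.Eventually.of_forall fun x => ?_)
    have hx := coe_ne_zero hn x
    have dh := fun a => (hh a).differentiableAt one_le_two hx
    have dhh := fun i a => (hhh i a).differentiableAt le_rfl hx
    have dL := hL.differentiableAt le_rfl hx
    have p1 : ∀ i, pd i (fun x => ∑ a, pd a φ x * pd a (pd i φ) x - pd i φ x * euclLap φ x) x =
        ∑ a, pd i (pd a φ) x ^ 2 + ∑ a, pd a φ x * pd i (pd a (pd i φ)) x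
          - pd i (pd i φ) x * euclLap φ x - ∑ a, pd i φ x * pd i (pd a (pd a φ)) x := by
      intro i
      rw [pd_sub (DifferentiableAt.fun_sum fun a _ => (dh a).fun_mul (dhh a i)) ((dh i).fun_mul dL),
        pd_sum (fun a _ => (dh a).fun_mul (dhh a i)), pd_mul (dh i) dL, ← Finset.mul_sum,
        ← Finset.sum_add_distrib]
      have : pd i (euclLap φ) x = ∑ a, pd i (pd a (pd a φ)) x := pd_sum (fun a _ => dhh a a) i
      rw [this, ← sub_sub]
      congr 2
      refine Finset.sum_congr rfl fun a _ => ?_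
      rw [pd_mul (dh a) (dhh a i), hφ.pd_comm (by norm_num) hx a i]
      ring
    have p2 : ∑ i, ∑ a, pd a φ x * pd i (pd a (pd i φ)) x =
        ∑ i, ∑ a, pd i φ x * pd i (pd a (pd a φ)) x := by
      rw [Finset.sum_comm]
      exact Finset.sum_congr rfl fun a _ => Finset.sum_congr rfl fun i _ => by
        rw [(hh i).pd_comm le_rfl hx]
    have e1 : ∑ i, pd i (fun x => ∑ a, pd a φ x * pd a (pd i φ) x - pd i φ x * euclLap φ x) x =
        ∑ i, ∑ a, pd i (pd a φ) x ^ 2 - euclLap φ x ^ 2 := by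
      simp only [p1, Finset.sum_add_distrib, Finset.sum_sub_distrib, p2, ← Finset.sum_mul]
      simp only [euclLap]
      ring
    have e2 : ∑ i, (x : Amb n) i * (∑ a, pd a φ x * pd a (pd i φ) x - pd i φ x * euclLap φ x) =
        -∑ i, pd i φ x ^ 2 := by
      have q1 : ∑ i, (x : Amb n) i * (∑ a, pd a φ x * pd a (pd i φ) x - pd i φ x * euclLap φ x) =
          ∑ a, pd a φ x * ∑ i, (x : Amb n) i * pd i (pd a φ) x -
            euclLap φ x * ∑ i, (x : Amb n) i * pd i φ x := by
        simp only [mul_sub, Finset.sum_sub_distrib, Finset.mul_sum]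
        rw [Finset.sum_comm]
        congr 1
        · exact Finset.sum_congr rfl fun a _ => Finset.sum_congr rfl fun i _ => by
            rw [hφ.pd_comm (by norm_num) hx a i]; ring
        · exact Finset.sum_congr rfl fun i _ => by ring
      rw [q1, hφ.euler_sum hx, ← Finset.sum_neg_distrib, zero_mul, mul_zero, sub_zero]
      exact Finset.sum_congr rfl fun a _ => by rw [(hh a).euler_sum hx]; ring
    simp only [e1, e2]
    ring
  -- Uses `(n - 3)/(n - 1) = 1 - 2/(n - 1)`.
  have split : ∀ x : Sph n,
      ∑ i, ∑ a, pd i (pd a φ) x ^ 2 - 2 / ((n : ℝ) - 1) * ∑ i, pd i φ x ^ 2 =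
      ((n : ℝ) - 1)⁻¹ * (((n : ℝ) - 1) * (∑ i, ∑ a, pd i (pd a φ) x ^ 2 - euclLap φ x ^ 2) +
      ((n : ℝ) - 3) * ∑ i, pd i φ x ^ 2) + (euclLap φ x ^ 2 - ∑ i, pd i φ x ^ 2) := by
    intro x
    field_simp
    ring
  simp only [split]
  rw [integral_add, integral_const_mul, key, integral_sub, hE]
  · ring
  · exact integrable_of_continuous (lφ.pow 2)
  · exact integrable_of_continuous hc1
  · exact integrable_of_continuous (continuous_const.mul
      ((continuous_const.mul (hc2.sub (lφ.pow 2))).add (continuous_const.mul hc1)))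
  · exact integrable_of_continuous ((lφ.pow 2).sub hc1)

/-! ### Riemannian operators through the radial extension -/

theorem tangentProj_apply {n : ℕ} (hn : 2 ≤ n) (x : Sph n) (v : Amb n) :
    tangentProj x v = v - (⟪(x : Amb n), v⟫ / ((n : ℝ) - 1)) • (x : Amb n) := by
  rw [tangentProj, Submodule.starProjection_orthogonal_val, Submodule.starProjection_singleton,
    norm_coe, radius_sq hn]
  simp

theorem mem_sphere_smul {n : ℕ} (hn : 2 ≤ n) {x : Amb n} (hx : x ≠ 0) :
    (radius n / ‖x‖) • x ∈ Metric.sphere (0 : Amb n) (radius n) := by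
  have : ‖x‖ ≠ 0 := norm_ne_zero_iff.2 hx
  simp [norm_smul, abs_of_pos (radius_pos hn), this]

theorem radialExt_apply {n : ℕ} (hn : 2 ≤ n) {F : Type*} [Zero F] (f : Sph n → F) {x : Amb n}
    (hx : x ≠ 0) : radialExt f x = f ⟨_, mem_sphere_smul hn hx⟩ := by
  rw [radialExt, dif_pos (mem_sphere_smul hn hx)]

theorem radialExt_coe {n : ℕ} (hn : 2 ≤ n) {F : Type*} [Zero F] (f : Sph n → F) (x : Sph n) :
    radialExt f x = f x := by
  rw [radialExt_apply hn f (coe_ne_zero hn x)]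
  congr 1
  ext1
  simp [(radius_pos hn).ne']

theorem radialExt_smul {n : ℕ} {F : Type*} [Zero F] (f : Sph n → F) (x : Amb n) {t : ℝ}
    (ht : 0 < t) : radialExt f (t • x) = radialExt f x := by
  have : (radius n / ‖t • x‖) • t • x = (radius n / ‖x‖) • x := by
    rw [smul_smul, norm_smul, Real.norm_of_nonneg ht.le]
    congr 1
    field_simp
  unfold radialExt
  congr! 3

/-- The extension is `F` composed with the smooth retraction onto the sphere, and constancy along
rays is the Euler relation of degree 0. -/
theorem IsCk.isHom {n : ℕ} (hn : 2 ≤ n) {k : ℕ} (hk : 1 ≤ k) {f : Sph n → ℝ}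
    (hf : IsCk (k : WithTop ℕ∞) f) : IsHom 0 k (radialExt f) := by
  obtain ⟨U, F, hU, hSU, hF, hFf⟩ := hf
  have hs : ContDiffOn ℝ k (radialExt f) {0}ᶜ := by
    have hr : ContDiffOn ℝ k (fun y : Amb n => (radius n / ‖y‖) • y) {0}ᶜ :=
      (contDiffOn_const.div (contDiffOn_id.norm ℝ fun x (hx : x ≠ 0) => hx)
        fun x (hx : x ≠ 0) => norm_ne_zero_iff.2 hx).smul contDiffOn_id
    refine (hF.comp hr fun x hx => hSU (mem_sphere_smul hn hx)).congr fun x hx => ?_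
    rw [radialExt_apply hn f hx, ← hFf]
    rfl
  refine ⟨hs, fun x hx => ?_⟩
  have hd : DifferentiableAt ℝ (radialExt f) x :=
    (hs.differentiableOn (by exact_mod_cast (Nat.one_le_iff_ne_zero.1 hk))).differentiableAt
      (isOpen_compl_singleton.mem_nhds hx)
  have h1 : HasDerivAt (fun t : ℝ => t • x) x 1 := by
    simpa using (hasDerivAt_id (1 : ℝ)).smul_const x
  have h2 : HasDerivAt (fun t : ℝ => radialExt f (t • x)) (fderiv ℝ (radialExt f) x x) 1 :=
    HasFDerivAt.comp_hasDerivAt (f := fun t : ℝ => t • x) (l := radialExt f) (1 : ℝ)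
      (by simpa using hd.hasFDerivAt) h1
  have h3 : HasDerivAt (fun t : ℝ => radialExt f (t • x)) 0 1 := by
    refine (hasDerivAt_const (1 : ℝ) (radialExt f x)).congr_of_eventuallyEq ?_
    filter_upwards [lt_mem_nhds one_pos] with t ht using radialExt_smul f x ht
  rw [h2.unique h3, zero_mul]

theorem isCk_of_contDiffOn {n : ℕ} (hn : 2 ≤ n) {k : WithTop ℕ∞} {F : Amb n → ℝ}
    (hF : ContDiffOn ℝ k F {0}ᶜ) {f : Sph n → ℝ} (h : ∀ x : Sph n, F x = f x) : IsCk k f :=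
  ⟨{0}ᶜ, F, isOpen_compl_singleton, fun x hx => coe_ne_zero hn ⟨x, hx⟩, hF, h⟩

theorem gradient_apply {n : ℕ} (φ : Amb n → ℝ) (x : Amb n) (i : Fin (n + 1)) :
    gradient φ x i = pd i φ x := by
  have h := congrArg (fun T : StrongDual ℝ (Amb n) => T (EuclideanSpace.single i (1 : ℝ)))
    (toDual_gradient (𝕜 := ℝ) (f := φ) (x := x))
  simp only [InnerProductSpace.toDual_apply_apply] at h
  rw [pd, ← h, EuclideanSpace.inner_single_right]
  simp

theorem inner_gradient {n : ℕ} (φ : Amb n → ℝ) (x v : Amb n) :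
    ⟪v, gradient φ x⟫ = fderiv ℝ φ x v := by
  rw [← toDual_gradient, InnerProductSpace.toDual_apply_apply, real_inner_comm]

/-- The radial derivative vanishes, so the Euclidean gradient is already tangent. -/
theorem grad_eq_gradient {n : ℕ} (hn : 2 ≤ n) {f : Sph n → ℝ} {k : ℕ}
    (h : IsHom 0 k (radialExt f)) (x : Sph n) : grad f x = gradient (radialExt f) x := by
  rw [grad, tangentProj_apply hn, inner_gradient, h.euler _ (coe_ne_zero hn x)]
  simp

theorem hasFDerivAt_radialRetraction {n : ℕ} (hn : 2 ≤ n) (x : Sph n) :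
    HasFDerivAt (fun y : Amb n => (radius n / ‖y‖) • y) (tangentProj x) x := by
  have hR := (radius_pos hn).ne'
  have hx : ‖(x : Amb n)‖ ^ 2 ≠ 0 := by rw [norm_coe]; exact pow_ne_zero _ hR
  have h1 := ((hasDerivAt_inv (Real.sqrt_ne_zero'.2 (by positivity))).comp_hasFDerivAt (x : Amb n)
    ((hasStrictFDerivAt_norm_sq (x : Amb n)).hasFDerivAt.sqrt hx)).const_mul (radius n)
  have h2 := h1.fun_smul (hasFDerivAt_id (x : Amb n))
  simp only [Real.sqrt_sq (norm_nonneg _), id, Function.comp_apply, ← div_eq_mul_inv] at h2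
  refine h2.congr_fderiv ?_
  ext1 v
  rw [tangentProj_apply hn, ← radius_sq hn]
  simp [hR, sub_eq_add_neg, smul_smul, ← neg_smul]
  congr 1
  field_simp

theorem gradient_eq_toLp {n : ℕ} (φ : Amb n → ℝ) :
    gradient φ = fun x => WithLp.toLp 2 fun i => pd i φ x := by
  ext x i
  simp [gradient_apply]

/-- Near `x` the extended gradient field is the Euclidean gradient composed with the retraction,
whose derivative is `tangentProj x`. The correction terms arise from the two projections: the
gradient has degree `-1`, so its derivative along `x` is minus itself, and the same relation gives
the normal component to be removed. -/
theorem hess_single_apply {n : ℕ} (hn : 2 ≤ n) {f : Sph n → ℝ} {k : ℕ} (hk : 2 ≤ k)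
    (h : IsHom 0 k (radialExt f)) (x : Sph n) (a b : Fin (n + 1)) :
    hess f x (EuclideanSpace.single b 1) a =
      pd b (pd a (radialExt f)) x + ((x : Amb n) b * pd a (radialExt f) x +
        pd b (radialExt f) x * (x : Amb n) a) / ((n : ℝ) - 1) := by
  set φ := radialExt f with hφ
  have hx := coe_ne_zero hn x
  have hp : ∀ i, IsHom (0 - 1) 1 (pd i φ) := fun i => h.pd hk le_rfl i
  set L : Amb n →L[ℝ] Amb n :=
    (PiLp.continuousLinearEquiv 2 ℝ fun _ => ℝ).symm.toContinuousLinearMap.comp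
      (ContinuousLinearMap.pi fun i => fderiv ℝ (pd i φ) x) with hL
  have hG : HasFDerivAt (gradient φ) L x := by
    rw [gradient_eq_toLp]
    exact (PiLp.continuousLinearEquiv 2 ℝ fun _ : Fin (n + 1) => ℝ).symm.hasFDerivAt.comp
      (x : Amb n)
      (hasFDerivAt_pi.2 fun i => ((hp i).differentiableAt le_rfl hx).hasFDerivAt)
  have hrx : (radius n / ‖(x : Amb n)‖) • (x : Amb n) = x := by
    simp [(radius_pos hn).ne']
  have hD : HasFDerivAt (radialExt (grad f)) (L.comp (tangentProj x)) x := by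
    have hG' : HasFDerivAt (gradient φ) L ((radius n / ‖(x : Amb n)‖) • (x : Amb n)) := by
      rwa [hrx]
    refine (HasFDerivAt.comp (f := fun y : Amb n => (radius n / ‖y‖) • y) (x : Amb n) hG'
      (hasFDerivAt_radialRetraction hn x)).congr_of_eventuallyEq ?_
    filter_upwards [isOpen_compl_singleton.mem_nhds hx] with y hy
    rw [radialExt_apply hn _ hy, grad_eq_gradient hn h]
    rfl
  have hPP : tangentProj x (tangentProj x (EuclideanSpace.single b (1 : ℝ))) =
      EuclideanSpace.single b 1 - ((x : Amb n) b / ((n : ℝ) - 1)) • (x : Amb n) := by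
    have : tangentProj x (tangentProj x (EuclideanSpace.single b (1 : ℝ))) =
        tangentProj x (EuclideanSpace.single b (1 : ℝ)) :=
      Submodule.starProjection_eq_self_iff.2 (Submodule.starProjection_apply_mem _ _)
    rw [this, tangentProj_apply hn, EuclideanSpace.inner_single_right]
    simp
  rw [hess, hD.fderiv]
  simp only [ContinuousLinearMap.comp_apply, hPP]
  set u := L (EuclideanSpace.single b 1 - ((x : Amb n) b / ((n : ℝ) - 1)) • (x : Amb n)) with hu
  have hui : ∀ i, u i = pd b (pd i φ) x + (x : Amb n) b / ((n : ℝ) - 1) * pd i φ x := by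
    intro i
    have : u i = fderiv ℝ (pd i φ) x
        (EuclideanSpace.single b 1 - ((x : Amb n) b / ((n : ℝ) - 1)) • (x : Amb n)) := rfl
    rw [this, map_sub, map_smul, (hp i).euler _ hx]
    simp [pd]
  have hxu : ⟪(x : Amb n), u⟫ = -pd b φ x := by
    have : ⟪(x : Amb n), u⟫ = ∑ i, (x : Amb n) i * pd i (pd b φ) x +
        (x : Amb n) b / ((n : ℝ) - 1) * ∑ i, (x : Amb n) i * pd i φ x := by
      rw [PiLp.inner_apply, Finset.mul_sum, ← Finset.sum_add_distrib]
      refine Finset.sum_congr rfl fun i _ => ?_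
      rw [hui, h.pd_comm hk hx b i]
      simp
      ring
    rw [this, (hp b).euler_sum hx, h.euler_sum hx]
    ring
  rw [tangentProj_apply hn, hxu]
  simp only [PiLp.sub_apply, PiLp.smul_apply, hui, smul_eq_mul]
  ring

/-- The corrections in `hess_single_apply` have trace proportional to the radial derivative, which
is zero. -/
theorem lap_eq_euclLap {n : ℕ} (hn : 2 ≤ n) {f : Sph n → ℝ} {k : ℕ} (hk : 2 ≤ k)
    (h : IsHom 0 k (radialExt f)) (x : Sph n) : lap f x = euclLap (radialExt f) x := by
  rw [lap, tr, LinearMap.trace_eq_sum_inner _ (EuclideanSpace.basisFun _ ℝ)]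
  have : ∀ i, ⟪EuclideanSpace.basisFun (Fin (n + 1)) ℝ i,
      (hess f x : Amb n →ₗ[ℝ] Amb n) (EuclideanSpace.basisFun (Fin (n + 1)) ℝ i)⟫ =
      pd i (pd i (radialExt f)) x +
        2 / ((n : ℝ) - 1) * ((x : Amb n) i * pd i (radialExt f) x) := by
    intro i
    rw [EuclideanSpace.basisFun_apply, EuclideanSpace.inner_single_left]
    have := hess_single_apply hn hk h x i i
    simp only [ContinuousLinearMap.coe_coe, this]
    simp
    ring
  simp only [this]
  rw [Finset.sum_add_distrib, ← Finset.mul_sum, h.euler_sum (coe_ne_zero hn x)]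
  simp [euclLap]

theorem hsSq_hess {n : ℕ} (hn : 2 ≤ n) {f : Sph n → ℝ} {k : ℕ} (hk : 2 ≤ k)
    (h : IsHom 0 k (radialExt f)) (x : Sph n) :
    hsSq (hess f x) = ∑ i, ∑ a, pd i (pd a (radialExt f)) x ^ 2 -
      2 / ((n : ℝ) - 1) * ∑ i, pd i (radialExt f) x ^ 2 := by
  set φ := radialExt f with hφ
  have hx := coe_ne_zero hn x
  have hn1 := sub_one_ne_zero hn
  have hp : ∀ i, IsHom (0 - 1) 1 (pd i φ) := fun i => h.pd hk le_rfl i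
  set c := ((n : ℝ) - 1)⁻¹ with hc
  -- Expand the square of the three-term formula. After summing over `b`, the two pure correction
  -- squares contribute `2c|∇φ|²` and the cross terms with `D²φ` contribute `-4c|∇φ|²`.
  have e : ∀ b, ‖hess f x (EuclideanSpace.single b 1)‖ ^ 2 =
      ∑ a, pd b (pd a φ) x ^ 2 + c ^ 2 * (x : Amb n) b ^ 2 * ∑ a, pd a φ x ^ 2
        + c ^ 2 * pd b φ x ^ 2 * ∑ a, (x : Amb n) a ^ 2
        + 2 * c * (x : Amb n) b * ∑ a, pd a φ x * pd b (pd a φ) x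
        + 2 * c * pd b φ x * ∑ a, (x : Amb n) a * pd a (pd b φ) x
        + 2 * c ^ 2 * (x : Amb n) b * pd b φ x * ∑ a, (x : Amb n) a * pd a φ x := by
    intro b
    rw [EuclideanSpace.norm_sq_eq]
    simp only [Finset.mul_sum, ← Finset.sum_add_distrib]
    refine Finset.sum_congr rfl fun a _ => ?_
    rw [hess_single_apply hn hk h, h.pd_comm hk hx a b, Real.norm_eq_abs, sq_abs, div_eq_mul_inv]
    ring
  have s1 : ∑ b, (x : Amb n) b * ∑ a, pd a φ x * pd b (pd a φ) x = -∑ a, pd a φ x ^ 2 := by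
    simp only [Finset.mul_sum]
    rw [Finset.sum_comm, ← Finset.sum_neg_distrib]
    refine Finset.sum_congr rfl fun a _ => ?_
    have := (hp a).euler_sum hx
    calc _ = pd a φ x * ∑ b, (x : Amb n) b * pd b (pd a φ) x := by
          rw [Finset.mul_sum]; exact Finset.sum_congr rfl fun b _ => by ring
      _ = _ := by rw [this]; ring
  have s2 : ∀ b, ∑ a, (x : Amb n) a * pd a (pd b φ) x = -pd b φ x := fun b => by
    rw [(hp b).euler_sum hx]; ring
  have s3 : ∑ a, (x : Amb n) a * pd a φ x = 0 := by rw [h.euler_sum hx]; ring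
  have s4 := sum_coord_sq hn x
  simp only [hsSq, e, s2, s3, s4, Finset.sum_add_distrib, mul_assoc, ← Finset.mul_sum,
    ← Finset.sum_mul, s1]
  have : ∑ i, pd i φ x * -pd i φ x = -∑ i, pd i φ x ^ 2 := by
    rw [← Finset.sum_neg_distrib]; exact Finset.sum_congr rfl fun b _ => by ring
  rw [this]
  rw [hc]
  simp
  field_simp
  ring

theorem norm_grad_sq {n : ℕ} (hn : 2 ≤ n) {f : Sph n → ℝ} {k : ℕ}
    (h : IsHom 0 k (radialExt f)) (x : Sph n) :
    ‖grad f x‖ ^ 2 = ∑ i, pd i (radialExt f) x ^ 2 := by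
  rw [grad_eq_gradient hn h, EuclideanSpace.norm_sq_eq]
  simp [gradient_apply]

theorem continuous_grad {n : ℕ} (hn : 2 ≤ n) {f : Sph n → ℝ} {k : ℕ} (hk : 1 ≤ k)
    (h : IsHom 0 k (radialExt f)) : Continuous (grad f) := by
  have : grad f = fun x : Sph n => WithLp.toLp 2 fun i => pd i (radialExt f) x := by
    ext1 x
    rw [grad_eq_gradient hn h, gradient_eq_toLp]
  rw [this]
  exact (PiLp.continuous_toLp 2 _).comp (continuous_pi fun i => h.continuous_pd hn hk i)

theorem continuous_hess {n : ℕ} (hn : 2 ≤ n) {f : Sph n → ℝ} {k : ℕ} (hk : 2 ≤ k)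
    (h : IsHom 0 k (radialExt f)) : Continuous (hess f) := by
  rw [continuous_clm_apply]
  intro v
  have hv : ∀ x, hess f x v = ∑ b, v b • hess f x (EuclideanSpace.single b 1) := fun x => by
    conv_lhs => rw [eq_sum_single v]
    simp [map_sum]
  simp only [hv]
  refine continuous_finsetSum _ fun b _ => Continuous.const_smul ?_ (v b)
  have : (fun x : Sph n => hess f x (EuclideanSpace.single b 1)) = fun x : Sph n =>
      WithLp.toLp 2 fun a => pd b (pd a (radialExt f)) x + ((x : Amb n) b * pd a (radialExt f) x +
        pd b (radialExt f) x * (x : Amb n) a) / ((n : ℝ) - 1) := by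
    ext x a
    rw [hess_single_apply hn hk h]
  rw [this]
  refine (PiLp.continuous_toLp 2 _).comp (continuous_pi fun a => ?_)
  have h1 : 1 ≤ k := by omega
  exact (h.continuous_pd_pd hn hk b a).add
    ((((continuous_coord b).mul (h.continuous_pd hn h1 a)).add
      ((h.continuous_pd hn h1 b).mul (continuous_coord a))).div_const _)

theorem eigval_zero (n : ℕ) : eigval n 0 = 0 := by simp [eigval]

/-! ### Integral identities for functions of class `C^k` -/

section IsCk

variable {n k : ℕ} {f g : Sph n → ℝ}

theorem IsCk.mul (hn : 2 ≤ n) (hk : 1 ≤ k) (hf : IsCk (k : WithTop ℕ∞) f)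
    (hg : IsCk (k : WithTop ℕ∞) g) : IsCk (k : WithTop ℕ∞) fun x => f x * g x :=
  isCk_of_contDiffOn hn ((hf.isHom hn hk).smooth.mul (hg.isHom hn hk).smooth) fun x => by
    simp [radialExt_coe hn]

theorem IsCk.sub (hn : 2 ≤ n) (hk : 1 ≤ k) (hf : IsCk (k : WithTop ℕ∞) f)
    (hg : IsCk (k : WithTop ℕ∞) g) : IsCk (k : WithTop ℕ∞) fun x => f x - g x :=
  isCk_of_contDiffOn hn ((hf.isHom hn hk).smooth.sub (hg.isHom hn hk).smooth) fun x => by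
    simp [radialExt_coe hn]

theorem IsCk.const_mul (hn : 2 ≤ n) (hk : 1 ≤ k) (hf : IsCk (k : WithTop ℕ∞) f) (c : ℝ) :
    IsCk (k : WithTop ℕ∞) fun x => c * f x :=
  isCk_of_contDiffOn hn ((contDiffOn_const (c := c)).mul (hf.isHom hn hk).smooth) fun x => by
    simp [radialExt_coe hn]

theorem IsCk.of_le {k l : WithTop ℕ∞} (hf : IsCk l f) (h : k ≤ l) : IsCk k f := by
  obtain ⟨U, F, hU, hSU, hF, hFf⟩ := hf
  exact ⟨U, F, hU, hSU, hF.of_le h, hFf⟩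

theorem IsCk.continuous {k : WithTop ℕ∞} (hf : IsCk k f) : Continuous f := by
  obtain ⟨U, F, hU, hSU, hF, hFf⟩ := hf
  rw [show f = fun x : Sph n => F x from funext fun x => (hFf x).symm]
  exact hF.continuousOn.comp_continuous continuous_subtype_val fun x => hSU x.2

theorem IsCk.lap (hn : 2 ≤ n) (hf : IsCk ((k + 2 : ℕ) : WithTop ℕ∞) f) :
    IsCk (k : WithTop ℕ∞) (lap f) := by
  have h := hf.isHom hn (by omega)
  exact isCk_of_contDiffOn hn (h.contDiffOn_euclLap le_rfl) fun x =>
    (lap_eq_euclLap hn (by omega) h x).symm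

theorem integral_mul_lap_comm (hn : 2 ≤ n) (hf : IsCk (2 : ℕ) f) (hg : IsCk (2 : ℕ) g) :
    ∫ x, g x * lap f x ∂(unif n) = ∫ x, f x * lap g x ∂(unif n) := by
  have hf' := hf.isHom hn one_le_two
  have hg' := hg.isHom hn one_le_two
  simpa [eigval_zero, radialExt_coe hn, ← lap_eq_euclLap hn le_rfl hf',
    ← lap_eq_euclLap hn le_rfl hg'] using integral_green hn hf' hg'

/-- Green's identity against the constant 1. -/
theorem integral_lap (hn : 2 ≤ n) (hf : IsCk (2 : ℕ) f) : ∫ x, lap f x ∂(unif n) = 0 := by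
  have hf' := hf.isHom hn one_le_two
  have h1 : euclLap (fun _ : Amb n => (1 : ℝ)) = 0 := by
    ext x
    have : ∀ i, pd i (fun _ : Amb n => (1 : ℝ)) = fun _ => 0 := fun i => by
      ext x; simp [pd]
    simp only [euclLap, this]
    simp [pd]
  simpa [eigval_zero, ← lap_eq_euclLap hn le_rfl hf', h1] using
    integral_green hn hf' (IsHom.const 1)

theorem integral_hsSq_hess (hn : 2 ≤ n) (hf : IsCk (3 : ℕ) f) :
    ∫ x, hsSq (hess f x) ∂(unif n) =
      ∫ x, lap f x ^ 2 ∂(unif n) + ∫ x, f x * lap f x ∂(unif n) := by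
  have h := hf.isHom hn (by norm_num)
  simpa only [hsSq_hess hn (by norm_num) h, lap_eq_euclLap hn (by norm_num) h,
    radialExt_coe hn] using integral_bochner hn h

theorem integral_norm_grad_sq (hn : 2 ≤ n) (hf : IsCk (2 : ℕ) f) :
    ∫ x, ‖grad f x‖ ^ 2 ∂(unif n) = -∫ x, f x * lap f x ∂(unif n) := by
  have h := hf.isHom hn (by norm_num)
  simpa only [norm_grad_sq hn h, lap_eq_euclLap hn (by norm_num) h,
    radialExt_coe hn] using integral_energy hn h

theorem continuous_hsSq : Continuous (hsSq (n := n)) := by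
  unfold hsSq
  fun_prop

/-- Terms of the form `Δ(·)` have mean zero and `Δ` is symmetric, so `Γ₁` integrates to `-∫ fΔf` and
`Γ₂` to `∫ (Δf)²`. Class `C⁴` makes `Δf` and `Γ₁` of class `C²`. -/
theorem integrable_gamma_sub (hn : 2 ≤ n) (hf : IsCk (4 : ℕ) f) :
    Integrable (fun x => Gam 2 f f x - Gam 1 f f x) (unif n) ∧
      ∫ x, (Gam 2 f f x - Gam 1 f f x) ∂(unif n) =
        ∫ x, lap f x ^ 2 ∂(unif n) + ∫ x, f x * lap f x ∂(unif n) := by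
  have h2 : IsCk (2 : ℕ) f := hf.of_le (by norm_num)
  have hL : IsCk (2 : ℕ) (SpherePoincare.lap f) := hf.lap hn
  have hff := (hf.mul hn (by norm_num) hf).lap (k := 2) hn
  have hfL := h2.mul hn one_le_two hL
  have hG : IsCk (2 : ℕ) (Gam 1 f f) :=
    ((hff.sub hn one_le_two hfL).sub hn one_le_two hfL).const_mul hn one_le_two (1 / 2)
  have cf := hf.continuous
  have cL := hL.continuous
  have cLL : Continuous (SpherePoincare.lap (SpherePoincare.lap f)) :=
    (IsCk.lap (k := 0) hn hL).continuous
  have cG := hG.continuous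
  have cLG : Continuous (SpherePoincare.lap (Gam 1 f f)) :=
    (IsCk.lap (k := 0) hn hG).continuous
  have cfL : Continuous (SpherePoincare.lap fun x => f x * SpherePoincare.lap f x) :=
    (IsCk.lap (k := 0) hn hfL).continuous
  have cff := hff.continuous
  have e1 : ∀ x, Gam 1 f f x = (1 / 2) * SpherePoincare.lap (fun x => f x * f x) x
      - f x * SpherePoincare.lap f x := fun x => by
    simp only [Gam]; ring
  have e2 : ∀ x, Gam 2 f f x = (1 / 2) * SpherePoincare.lap (Gam 1 f f) x
      - (1 / 2) * SpherePoincare.lap (fun x => f x * SpherePoincare.lap f x) x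
      + (1 / 2) * (f x * SpherePoincare.lap (SpherePoincare.lap f) x)
      + (1 / 2) * SpherePoincare.lap f x ^ 2 := fun x => by
    simp only [Gam]; ring
  have i1 := integral_lap hn hG
  have i2 := integral_lap hn hfL
  have i3 := integral_lap hn (h2.mul hn one_le_two h2)
  have i4 := integral_mul_lap_comm hn hL h2
  have c1 : Continuous fun x => f x * SpherePoincare.lap (SpherePoincare.lap f) x := cf.mul cLL
  have c2 : Continuous fun x => SpherePoincare.lap f x ^ 2 := cL.pow 2
  have c3 : Continuous fun x => f x * SpherePoincare.lap f x := cf.mul cL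
  have c4 : Continuous (Gam 2 f f) := by
    rw [funext e2]
    fun_prop
  have j1 := integrable_of_continuous c1
  have j2 := integrable_of_continuous c2
  have j3 := integrable_of_continuous c3
  have j4 := integrable_of_continuous cLG
  have j5 := integrable_of_continuous cfL
  have j6 := integrable_of_continuous cff
  refine ⟨integrable_of_continuous (c4.sub cG), ?_⟩
  rw [integral_sub (integrable_of_continuous c4) (integrable_of_continuous cG)]
  have k1 : ∫ x, Gam 1 f f x ∂(unif n) = -∫ x, f x * SpherePoincare.lap f x ∂(unif n) := by
    simp only [e1]
    rw [integral_sub (j6.const_mul _) j3, integral_const_mul, i3]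
    ring
  have k2 : ∫ x, Gam 2 f f x ∂(unif n) = ∫ x, SpherePoincare.lap f x ^ 2 ∂(unif n) := by
    simp only [e2]
    rw [integral_add, integral_add, integral_sub]
    rotate_left
    iterate 6 exact integrable_of_continuous (by fun_prop)
    simp only [integral_const_mul, i1, i2, i4]
    simp only [← sq]
    ring
  rw [k1, k2]
  ring

end IsCk

/-! ### Powers of linear functions -/

section LinearPowers

variable {n : ℕ}

theorem hasFDerivAt_inner_pow (a x : Amb n) (j : ℕ) :
    HasFDerivAt (fun y : Amb n => ⟪a, y⟫ ^ j) ((j * ⟪a, x⟫ ^ (j - 1)) • innerSL ℝ a) x := by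
  have := ((innerSL ℝ a).hasFDerivAt (x := x)).pow j
  simpa [nsmul_eq_mul] using this

theorem pd_inner_pow (a : Amb n) (j : ℕ) (i : Fin (n + 1)) :
    pd i (fun y : Amb n => ⟪a, y⟫ ^ j) = fun x => j * a i * ⟪a, x⟫ ^ (j - 1) := by
  ext x
  rw [pd, (hasFDerivAt_inner_pow a x j).fderiv]
  simp [EuclideanSpace.inner_single_right]
  ring

theorem isHom_inner_pow (a : Amb n) (j k : ℕ) : IsHom j k fun y : Amb n => ⟪a, y⟫ ^ j := by
  refine ⟨(contDiff_const.inner ℝ contDiff_id).pow j |>.contDiffOn, fun x _ => ?_⟩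
  rw [(hasFDerivAt_inner_pow a x j).fderiv]
  rcases j with _ | j
  · simp
  · simp [pow_succ]; ring

/-- For `j < 2` the exponent `j - 2` is truncated to 0, harmlessly: the factor `j * (j - 1)`
vanishes. -/
theorem euclLap_inner_pow (a x : Amb n) (j : ℕ) :
    euclLap (fun y : Amb n => ⟪a, y⟫ ^ j) x = j * (j - 1) * ‖a‖ ^ 2 * ⟪a, x⟫ ^ (j - 2) := by
  have h : ∀ i, pd i (pd i fun y : Amb n => ⟪a, y⟫ ^ j) x =
      j * (j - 1) * ⟪a, x⟫ ^ (j - 2) * a i ^ 2 := by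
    intro i
    have : pd i (fun y : Amb n => j * a i * ⟪a, y⟫ ^ (j - 1)) x =
        j * a i * pd i (fun y : Amb n => ⟪a, y⟫ ^ (j - 1)) x := by
      simp only [pd]
      rw [fderiv_const_mul (hasFDerivAt_inner_pow a x _).differentiableAt]
      simp
    rw [pd_inner_pow, this, pd_inner_pow, Nat.sub_sub]
    rcases j with _ | j
    · simp
    · simp; ring
  simp only [euclLap, h, ← Finset.mul_sum]
  rw [EuclideanSpace.norm_sq_eq]
  simp
  ring

end LinearPowers

/-! ### Norm comparison along an exhausting chain of subspaces -/

section Hilbert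

variable {E : Type*} [NormedAddCommGroup E] [InnerProductSpace ℝ E]

/-- If `U 0 ≤ U 1 ≤ …` exhausts a Hilbert space and every increment `U (k+1) ⊖ U k` sees at
least as much of `y` as of `x`, then `‖x‖ ≤ ‖y‖`. -/
theorem norm_le_of_forall_norm_increment_le (U : ℕ → Submodule ℝ E)
    [∀ k, (U k).HasOrthogonalProjection] (hU : Monotone U) (h0 : U 0 = ⊥)
    (hd : ⊤ ≤ (⨆ k, U k).topologicalClosure) {x y : E}
    (h : ∀ k, ‖(U (k + 1)).starProjection x - (U k).starProjection x‖ ≤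
      ‖(U (k + 1)).starProjection y - (U k).starProjection y‖) : ‖x‖ ≤ ‖y‖ := by
  -- Pythagoras: the increment is orthogonal to the smaller subspace, so squared norms of the
  -- projections telescope.
  have pyth : ∀ (z : E) k, ‖(U (k + 1)).starProjection z‖ ^ 2 =
      ‖(U k).starProjection z‖ ^ 2 +
        ‖(U (k + 1)).starProjection z - (U k).starProjection z‖ ^ 2 := by
    intro z k
    have hk : (U k).starProjection z = (U k).starProjection ((U (k + 1)).starProjection z) := by
      have := DFunLike.congr_fun
        (Submodule.starProjection_comp_starProjection_of_le (hU (Nat.le_succ k))) z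
      exact this.symm
    have ho : ⟪(U k).starProjection z,
        (U (k + 1)).starProjection z - (U k).starProjection z⟫ = 0 := by
      rw [real_inner_comm]
      conv_lhs => rw [hk]
      rw [← hk]
      have := Submodule.starProjection_inner_eq_zero (K := U k) ((U (k + 1)).starProjection z)
        ((U k).starProjection z) (Submodule.starProjection_apply_mem _ _)
      rwa [← hk] at this
    have := norm_add_sq_real ((U k).starProjection z)
      ((U (k + 1)).starProjection z - (U k).starProjection z)
    rw [ho, add_sub_cancel] at this
    linarith
  have hle : ∀ k, ‖(U k).starProjection x‖ ^ 2 ≤ ‖(U k).starProjection y‖ ^ 2 := by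
    intro k
    induction k with
    | zero =>
      have : ∀ z, (U 0).starProjection z = 0 := fun z =>
        (Submodule.eq_bot_iff _).1 h0 _ (Submodule.starProjection_apply_mem _ _)
      simp [this]
    | succ k ih =>
      rw [pyth, pyth]
      have := h k
      gcongr
  have tx := (Submodule.starProjection_tendsto_self U hU x hd).norm.pow 2
  have ty := (Submodule.starProjection_tendsto_self U hU y hd).norm.pow 2
  exact (pow_le_pow_iff_left₀ (norm_nonneg _) (norm_nonneg _) two_ne_zero).1
    (le_of_tendsto_of_tendsto' tx ty hle)

end Hilbert

variable {n : ℕ}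

/-! ### Polynomials in `L²` and the weak Laplacian -/

/-- The class in `L²` of the `j`-th power of the linear function `x ↦ ⟨a, x⟩`. -/
noncomputable def linPow (n : ℕ) (a : Amb n) (j : ℕ) : Lp ℝ 2 (unif n) :=
  ContinuousMap.toLp (E := ℝ) 2 (unif n) ℝ ⟨fun x => ⟪a, (x : Amb n)⟫ ^ j, by fun_prop⟩

/-- The class in `L²` of the spherical Laplacian of `x ↦ ⟨a, x⟩ ^ j`. -/
noncomputable def lapLinPow (n : ℕ) (a : Amb n) (j : ℕ) : Lp ℝ 2 (unif n) :=
  (j * (j - 1) * ‖a‖ ^ 2 : ℝ) • linPow n a (j - 2) - eigval n j • linPow n a j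

/-- `G` is the weak Laplacian of `F`, tested against polynomials. -/
def IsWeakLap (F G : Lp ℝ 2 (unif n)) : Prop :=
  ∀ a j, ⟪G, linPow n a j⟫ = ⟪F, lapLinPow n a j⟫

/-- The restrictions to the sphere of the polynomials of degree less than `k`. -/
noncomputable def polyLT (n k : ℕ) : Submodule ℝ (Lp ℝ 2 (unif n)) :=
  Submodule.span ℝ {p | ∃ a j, j < k ∧ linPow n a j = p}

theorem linPow_mem_polyLT (a : Amb n) {j k : ℕ} (h : j < k) : linPow n a j ∈ polyLT n k :=
  Submodule.subset_span ⟨a, j, h, rfl⟩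

theorem polyLT_mono : Monotone (polyLT n) := fun _ _ hkl =>
  Submodule.span_mono fun _ ⟨a, j, hj, h⟩ => ⟨a, j, hj.trans_le hkl, h⟩

theorem polyLT_zero : polyLT n 0 = ⊥ := by simp [polyLT]

theorem inner_toLp_continuous (f g : C(Sph n, ℝ)) :
    ⟪ContinuousMap.toLp (E := ℝ) 2 (unif n) ℝ f, ContinuousMap.toLp (E := ℝ) 2 (unif n) ℝ g⟫ =
      ∫ x, f x * g x ∂(unif n) := by
  rw [ContinuousMap.inner_toLp]
  simp [mul_comm]

theorem mul_sub_one_smul_linPow_mem (a : Amb n) {j k : ℕ} (h : j ≤ k) :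
    (j * (j - 1) * ‖a‖ ^ 2 : ℝ) • linPow n a (j - 2) ∈ polyLT n k := by
  rcases Nat.lt_or_ge j 2 with hj | hj
  · interval_cases j <;> simp
  · exact Submodule.smul_mem _ _ (linPow_mem_polyLT a (by omega))

theorem lapLinPow_eq (a : Amb n) (j : ℕ) : lapLinPow n a j =
    ContinuousMap.toLp (E := ℝ) 2 (unif n) ℝ ⟨fun x =>
      j * (j - 1) * ‖a‖ ^ 2 * ⟪a, (x : Amb n)⟫ ^ (j - 2) - eigval n j * ⟪a, (x : Amb n)⟫ ^ j,
      by fun_prop⟩ := by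
  rw [lapLinPow, linPow, linPow, ← map_smul, ← map_smul, ← map_sub]
  rfl

theorem isWeakLap_linPow (hn : 2 ≤ n) (b : Amb n) (m : ℕ) :
    IsWeakLap (linPow n b m) (lapLinPow n b m) := by
  intro a j
  rw [lapLinPow_eq, lapLinPow_eq, linPow, linPow, inner_toLp_continuous, inner_toLp_continuous]
  have := integral_green hn (isHom_inner_pow b m 2) (isHom_inner_pow a j 2)
  simp only [euclLap_inner_pow] at this
  simp only [ContinuousMap.coe_mk]
  rw [← this]
  exact integral_congr_ae (Filter.Eventually.of_forall fun x => mul_comm _ _)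

/-- Green's identity with the radial extension in degree 0, whose eigenvalue term is zero. -/
theorem isWeakLap_lap (hn : 2 ≤ n) {f : Sph n → ℝ} (hf : IsCk (2 : ℕ) f) :
    IsWeakLap (ContinuousMap.toLp (E := ℝ) 2 (unif n) ℝ ⟨f, hf.continuous⟩)
      (ContinuousMap.toLp (E := ℝ) 2 (unif n) ℝ
        ⟨lap f, (IsCk.lap (k := 0) hn hf).continuous⟩) := by
  intro a j
  rw [lapLinPow_eq, linPow, inner_toLp_continuous, inner_toLp_continuous]
  have hf' := hf.isHom hn one_le_two
  have := integral_green hn hf' (isHom_inner_pow a j 2)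
  simp only [euclLap_inner_pow, ← lap_eq_euclLap hn le_rfl hf', radialExt_coe hn, eigval_zero,
    zero_mul, sub_zero] at this
  simp only [ContinuousMap.coe_mk]
  rw [← this]
  exact integral_congr_ae (Filter.Eventually.of_forall fun x => mul_comm _ _)

theorem IsWeakLap.add {F G F' G' : Lp ℝ 2 (unif n)} (h : IsWeakLap F G) (h' : IsWeakLap F' G') :
    IsWeakLap (F + F') (G + G') := fun a j => by
  rw [inner_add_left, inner_add_left, h, h']

theorem IsWeakLap.smul {F G : Lp ℝ 2 (unif n)} (h : IsWeakLap F G) (c : ℝ) :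
    IsWeakLap (c • F) (c • G) := fun a j => by
  rw [inner_smul_left, inner_smul_left, h]

theorem exists_isWeakLap_of_mem_polyLT (hn : 2 ≤ n) {k : ℕ} {q : Lp ℝ 2 (unif n)}
    (hq : q ∈ polyLT n k) : ∃ q' ∈ polyLT n k, IsWeakLap q q' := by
  induction hq using Submodule.span_induction with
  | mem p hp =>
    obtain ⟨a, j, hj, rfl⟩ := hp
    exact ⟨lapLinPow n a j, Submodule.sub_mem _ (mul_sub_one_smul_linPow_mem a hj.le)
      (Submodule.smul_mem _ _ (linPow_mem_polyLT a hj)), isWeakLap_linPow hn a j⟩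
  | zero => exact ⟨0, Submodule.zero_mem _, fun a j => by simp⟩
  | add x y _ _ hx hy =>
    obtain ⟨x', hx', wx⟩ := hx
    obtain ⟨y', hy', wy⟩ := hy
    exact ⟨_, Submodule.add_mem _ hx' hy', wx.add wy⟩
  | smul c x _ hx =>
    obtain ⟨x', hx', wx⟩ := hx
    exact ⟨_, Submodule.smul_mem _ c hx', wx.smul c⟩

/-- On polynomials of degree at most `k`, the Laplacian is `-eigval n k` up to lower order. -/
theorem exists_lower_order {k : ℕ} {p : Lp ℝ 2 (unif n)}
    (hp : p ∈ polyLT n (k + 1)) : ∃ q ∈ polyLT n k, ∀ F G, IsWeakLap F G →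
      ⟪G, p⟫ = ⟪F, q⟫ - eigval n k * ⟪F, p⟫ := by
  induction hp using Submodule.span_induction with
  | mem p hp =>
    obtain ⟨a, j, hj, rfl⟩ := hp
    -- The spherical Laplacian of the power plus `eigval n k` times the power; in the top degree `j
    -- = k` the second summand vanishes.
    refine ⟨(j * (j - 1) * ‖a‖ ^ 2 : ℝ) • linPow n a (j - 2) +
      (eigval n k - eigval n j) • linPow n a j,
      Submodule.add_mem _ (mul_sub_one_smul_linPow_mem a (Nat.lt_succ_iff.1 hj)) ?_, ?_⟩
    · rcases (Nat.lt_succ_iff.1 hj).eq_or_lt with rfl | h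
      · simp
      · exact Submodule.smul_mem _ _ (linPow_mem_polyLT a h)
    · intro F G h
      rw [h a j, lapLinPow, inner_sub_right, inner_add_right, inner_smul_right, inner_smul_right,
        inner_smul_right]
      ring
  | zero => exact ⟨0, Submodule.zero_mem _, fun F G _ => by simp⟩
  | add x y _ _ hx hy =>
    obtain ⟨x', hx', wx⟩ := hx
    obtain ⟨y', hy', wy⟩ := hy
    refine ⟨_, Submodule.add_mem _ hx' hy', fun F G h => ?_⟩
    rw [inner_add_right, inner_add_right, inner_add_right, wx F G h, wy F G h]
    ring
  | smul c x _ hx =>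
    obtain ⟨x', hx', wx⟩ := hx
    refine ⟨_, Submodule.smul_mem _ c hx', fun F G h => ?_⟩
    rw [inner_smul_right, inner_smul_right, inner_smul_right, wx F G h]
    ring

/-- Polynomials of degree `k` that are orthogonal to those of lower degree are eigenfunctions. -/
theorem inner_eq_of_mem_orthogonal (hn : 2 ≤ n) {k : ℕ} {p : Lp ℝ 2 (unif n)}
    (hp : p ∈ polyLT n (k + 1)) (hp' : p ∈ (polyLT n k)ᗮ) {F G : Lp ℝ 2 (unif n)}
    (h : IsWeakLap F G) : ⟪G, p⟫ = -eigval n k * ⟪F, p⟫ := by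
  obtain ⟨q, hq, hqp⟩ := exists_lower_order hp
  obtain ⟨q', hq', hqq'⟩ := exists_isWeakLap_of_mem_polyLT hn hq
  -- Test with `F = q` itself: both `q` and its Laplacian `q'` are orthogonal to `p`, so the
  -- identity collapses to `⟪q, q⟫ = 0`, and no lower-order term remains.
  have h1 := hqp q q' hqq'
  rw [(Submodule.mem_orthogonal _ _).1 hp' _ hq', (Submodule.mem_orthogonal _ _).1 hp' _ hq] at h1
  have : q = 0 := by
    rw [← inner_self_eq_zero (𝕜 := ℝ)]
    linarith
  rw [hqp F G h, this, inner_zero_right]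
  ring

instance finiteDimensional_polyLT (k : ℕ) : FiniteDimensional ℝ (polyLT n k) := by
  let ℓ : Amb n →ₗ[ℝ] C(Sph n, ℝ) :=
    { toFun := fun a => ⟨fun x => ⟪a, (x : Amb n)⟫, by fun_prop⟩
      map_add' := fun a b => by ext x; simp [inner_add_left]
      map_smul' := fun c a => by ext x; simp [inner_smul_left] }
  let T : C(Sph n, ℝ) →ₗ[ℝ] Lp ℝ 2 (unif n) :=
    (ContinuousMap.toLp (E := ℝ) 2 (unif n) ℝ).toLinearMap
  -- Powers of the finite-dimensional space of linear functions, taken in the algebra of continuous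
  -- functions, stay finite-dimensional.
  let W : Fin k → Submodule ℝ (Lp ℝ 2 (unif n)) := fun j => ((LinearMap.range ℓ) ^ (j : ℕ)).map T
  have hW : ∀ j, FiniteDimensional ℝ (W j) := fun j =>
    Module.Finite.iff_fg.2 (((Module.Finite.iff_fg.1 inferInstance).pow _).map T)
  have hle : polyLT n k ≤ ⨆ j, W j := by
    refine Submodule.span_le.2 ?_
    rintro _ ⟨a, j, hj, rfl⟩
    exact Submodule.mem_iSup_of_mem (⟨j, hj⟩ : Fin k)
      (Submodule.mem_map.2 ⟨ℓ a ^ j,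
        Submodule.pow_mem_pow _ (LinearMap.mem_range_self ℓ a) j, by rfl⟩)
  exact Submodule.finiteDimensional_of_le hle

/-- Polynomials are dense in `L²` of the sphere: exponentials of linear functions span an algebra
that separates points, and they are sums of power series. -/
theorem top_le_closure_polyLT : ⊤ ≤ (⨆ k, polyLT n k).topologicalClosure := by
  let ℓ : Amb n → C(Sph n, ℝ) := fun a => ⟨fun x => ⟪a, (x : Amb n)⟫, by fun_prop⟩
  let Q : Submodule ℝ C(Sph n, ℝ) := Submodule.span ℝ {p | ∃ a j, ℓ a ^ j = p}
  let S : Submonoid C(Sph n, ℝ) :=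
    { carrier := Set.range fun a =>
        (⟨fun x => Real.exp ⟪a, (x : Amb n)⟫, by fun_prop⟩ : C(Sph n, ℝ))
      one_mem' := ⟨0, by ext x; simp⟩
      mul_mem' := by
        rintro _ _ ⟨a, rfl⟩ ⟨b, rfl⟩
        exact ⟨a + b, by ext x; simp [inner_add_left, Real.exp_add]⟩ }
  have hexp : ∀ f : C(Sph n, ℝ), HasSum (fun j : ℕ => ((j.factorial : ℝ)⁻¹) • f ^ j)
      (⟨fun x => Real.exp (f x), by fun_prop⟩ : C(Sph n, ℝ)) := by
    intro f
    have h := NormedSpace.exp_series_hasSum_exp' (𝕂 := ℝ) f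
    have heq : NormedSpace.exp f = ⟨fun x => Real.exp (f x), by fun_prop⟩ := by
      ext x
      have h1 := (ContinuousMap.evalCLM ℝ x : C(Sph n, ℝ) →L[ℝ] ℝ).hasSum h
      have h2 := NormedSpace.exp_series_hasSum_exp' (𝕂 := ℝ) (f x)
      simp only [ContinuousMap.coe_mk]
      rw [Real.exp_eq_exp_ℝ]
      exact h1.unique h2
    rwa [heq] at h
  have hQ : Q.topologicalClosure = ⊤ := by
    let A := Algebra.adjoin ℝ (S : Set C(Sph n, ℝ))
    have hA : A.SeparatesPoints := by
      intro x y hxy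
      have hxy' : (x : Amb n) - y ≠ 0 := sub_ne_zero.2 fun h => hxy (Subtype.ext h)
      refine ⟨_, ⟨_, Algebra.subset_adjoin ⟨(x : Amb n) - y, rfl⟩, rfl⟩, fun h => hxy' ?_⟩
      have h' : ⟪(x : Amb n) - y, (x : Amb n)⟫ = ⟪(x : Amb n) - y, (y : Amb n)⟫ :=
        Real.exp_injective h
      rw [← inner_self_eq_zero (𝕜 := ℝ), inner_sub_right, h', sub_self]
    have h1 := ContinuousMap.subalgebra_topologicalClosure_eq_top_of_separatesPoints A hA
    have h2 : (Subalgebra.toSubmodule A) ≤ Q.topologicalClosure := by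
      -- Exponentials of linear functions are closed under products, so the algebra they generate is
      -- their linear span; only a single exponential has to be approximated, by partial sums of its
      -- series.
      rw [Algebra.adjoin_eq_span_of_subset _ (by rw [S.closure_eq]; exact Submodule.subset_span)]
      refine Submodule.span_le.2 ?_
      rintro _ ⟨a, rfl⟩
      refine mem_closure_of_tendsto (hexp (ℓ a)) (Filter.Eventually.of_forall fun s => ?_)
      exact Submodule.sum_mem _ fun j _ =>
        Submodule.smul_mem _ _ (Submodule.subset_span ⟨a, j, rfl⟩)
    rw [eq_top_iff]
    intro f _
    have hf : f ∈ A.topologicalClosure := h1 ▸ Algebra.mem_top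
    exact (closure_minimal h2 Q.isClosed_topologicalClosure) hf
  have hd := (ContinuousMap.toLp_denseRange ℝ (unif n) ℝ
    (ENNReal.ofNat_ne_top (n := 2))).topologicalClosure_map_submodule hQ
  rw [← hd]
  refine Submodule.topologicalClosure_mono ?_
  rw [Submodule.map_span_le]
  rintro _ ⟨a, j, rfl⟩
  exact Submodule.mem_iSup_of_mem (j + 1) (linPow_mem_polyLT a (Nat.lt_succ_self j))

/-! ### Eigenvalue bounds and spectral gaps -/

theorem one_le_eigval (hn : 2 ≤ n) {k : ℕ} (hk : 1 ≤ k) : 1 ≤ eigval n k := by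
  have h1 : (1 : ℝ) ≤ k := by exact_mod_cast hk
  have h2 : (2 : ℝ) ≤ n := by exact_mod_cast hn
  rw [eigval, le_div_iff₀ (by linarith)]
  nlinarith

theorem two_le_eigval (hn : 2 ≤ n) {k : ℕ} (hk : 2 ≤ k) : 2 ≤ eigval n k := by
  have h1 : (2 : ℝ) ≤ k := by exact_mod_cast hk
  have h2 : (2 : ℝ) ≤ n := by exact_mod_cast hn
  rw [eigval, le_div_iff₀ (by linarith)]
  nlinarith

/-- The projection onto polynomials of degree `k` orthogonal to those of lower degree. -/
noncomputable def increment (k : ℕ) : Lp ℝ 2 (unif n) →L[ℝ] Lp ℝ 2 (unif n) :=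
  (polyLT n (k + 1)).starProjection - (polyLT n k).starProjection

theorem increment_apply (k : ℕ) (F : Lp ℝ 2 (unif n)) :
    increment k F = (polyLT n (k + 1)).starProjection F - (polyLT n k).starProjection F := rfl

theorem increment_mem (k : ℕ) (F : Lp ℝ 2 (unif n)) : increment k F ∈ polyLT n (k + 1) :=
  Submodule.sub_mem _ (Submodule.starProjection_apply_mem _ _)
    (polyLT_mono (Nat.le_succ k) (Submodule.starProjection_apply_mem _ _))

theorem increment_mem_orthogonal (k : ℕ) (F : Lp ℝ 2 (unif n)) :
    increment k F ∈ (polyLT n k)ᗮ := by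
  rw [increment_apply, show (polyLT n (k + 1)).starProjection F - (polyLT n k).starProjection F =
    (F - (polyLT n k).starProjection F) - (F - (polyLT n (k + 1)).starProjection F) by abel]
  exact Submodule.sub_mem _ (Submodule.sub_starProjection_mem_orthogonal _)
    (Submodule.orthogonal_le (polyLT_mono (Nat.le_succ k))
      (Submodule.sub_starProjection_mem_orthogonal _))

theorem inner_increment {k : ℕ} (F : Lp ℝ 2 (unif n)) {p : Lp ℝ 2 (unif n)}
    (hp : p ∈ polyLT n (k + 1)) (hp' : p ∈ (polyLT n k)ᗮ) : ⟪increment k F, p⟫ = ⟪F, p⟫ := by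
  have h1 := Submodule.starProjection_inner_eq_zero F p hp
  have h2 := (Submodule.mem_orthogonal _ _).1 hp' _
    (Submodule.starProjection_apply_mem (polyLT n k) F)
  rw [inner_sub_left] at h1
  rw [increment_apply, inner_sub_left, h2]
  linarith

/-- The difference `w` of the two sides lies in the degree-`k` eigenspace, and pairing it with
itself gives zero by `inner_eq_of_mem_orthogonal`. Thus `Δ` acts diagonally on the increments, with
no smoothness assumed. -/
theorem IsWeakLap.increment_eq (hn : 2 ≤ n) {F G : Lp ℝ 2 (unif n)} (h : IsWeakLap F G) (k : ℕ) :
    increment k G = -eigval n k • increment k F := by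
  set w := increment k G - -eigval n k • increment k F with hw
  have h1 : w ∈ polyLT n (k + 1) :=
    Submodule.sub_mem _ (increment_mem k G) (Submodule.smul_mem _ _ (increment_mem k F))
  have h2 : w ∈ (polyLT n k)ᗮ :=
    Submodule.sub_mem _ (increment_mem_orthogonal k G)
      (Submodule.smul_mem _ _ (increment_mem_orthogonal k F))
  rw [← sub_eq_zero, ← hw, ← inner_self_eq_zero (𝕜 := ℝ)]
  nth_rewrite 1 [hw]
  rw [inner_sub_left, inner_smul_left, inner_increment G h1 h2, inner_increment F h1 h2,
    inner_eq_of_mem_orthogonal hn h1 h2 h]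
  simp

theorem increment_eq_zero {k m : ℕ} (hkm : k < m) {F : Lp ℝ 2 (unif n)} (h : F ∈ (polyLT n m)ᗮ) :
    increment k F = 0 := by
  rw [← inner_self_eq_zero (𝕜 := ℝ),
    inner_increment F (increment_mem k F) (increment_mem_orthogonal k F), real_inner_comm]
  exact (Submodule.mem_orthogonal _ _).1 h _ (polyLT_mono hkm (increment_mem k F))

theorem increment_eq_zero_of_mem {k m : ℕ} (hmk : m ≤ k) {F : Lp ℝ 2 (unif n)}
    (h : F ∈ polyLT n m) : increment k F = 0 := by
  rw [increment_apply, Submodule.starProjection_eq_self_iff.2 (polyLT_mono hmk h),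
    Submodule.starProjection_eq_self_iff.2 (polyLT_mono (hmk.trans (Nat.le_succ k)) h), sub_self]

theorem norm_le_of_increment_le {F G : Lp ℝ 2 (unif n)}
    (h : ∀ k, ‖increment k F‖ ≤ ‖increment k G‖) : ‖F‖ ≤ ‖G‖ :=
  norm_le_of_forall_norm_increment_le (polyLT n) polyLT_mono polyLT_zero top_le_closure_polyLT h

/-- Both are the constant 1, also for the zero vector since `0 ^ 0 = 1`; `linPow n 0 0` below stands
for this constant. -/
theorem linPow_zero (a b : Amb n) : linPow n a 0 = linPow n b 0 := by
  unfold linPow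
  congr 2

theorem mem_orthogonal_polyLT_one {F : Lp ℝ 2 (unif n)} (h : ⟪F, linPow n 0 0⟫ = 0) :
    F ∈ (polyLT n 1)ᗮ := by
  rw [Submodule.mem_orthogonal']
  intro p hp
  induction hp using Submodule.span_induction with
  | mem p hp =>
    obtain ⟨a, j, hj, rfl⟩ := hp
    obtain rfl : j = 0 := by omega
    rw [linPow_zero a 0, h]
  | zero => simp
  | add x y _ _ hx hy => rw [inner_add_right, hx, hy, add_zero]
  | smul c x _ hx => rw [inner_smul_right, hx, mul_zero]

/-- A weak form of the spectral gap: `‖F‖ ≤ ‖ΔF‖` for mean zero `F`. -/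
theorem IsWeakLap.norm_le (hn : 2 ≤ n) {F G : Lp ℝ 2 (unif n)} (h : IsWeakLap F G)
    (h0 : ⟪F, linPow n 0 0⟫ = 0) : ‖F‖ ≤ ‖G‖ := by
  refine norm_le_of_increment_le fun k => ?_
  rcases Nat.eq_zero_or_pos k with rfl | hk
  · rw [increment_eq_zero one_pos (mem_orthogonal_polyLT_one h0), norm_zero]
    exact norm_nonneg _
  · rw [h.increment_eq hn, norm_smul, norm_neg, Real.norm_eq_abs]
    have := one_le_eigval hn hk
    exact le_mul_of_one_le_left (norm_nonneg _) (this.trans (le_abs_self _))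

theorem linFun_eq (a : Amb n) : linFun n a = linPow n a 1 := by
  simp only [linPow, pow_one]
  rfl

/-- Eigenfunctions for the distinct eigenvalues `eigval n 1` and 0 are orthogonal. -/
theorem inner_linPow_one_zero (hn : 2 ≤ n) (a b : Amb n) : ⟪linPow n a 1, linPow n b 0⟫ = 0 := by
  have h := isWeakLap_linPow hn a 1 b 0
  have h1 := one_le_eigval hn le_rfl
  rw [Nat.cast_one] at h1
  simp only [lapLinPow, Nat.cast_one, Nat.cast_zero, eigval_zero, sub_self, mul_zero, zero_mul,
    zero_smul, zero_sub, inner_neg_left, inner_smul_left, inner_zero_right] at h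
  have h2 : eigval n 1 ≠ 0 := by linarith
  simpa [h2] using h

/-- `‖F - Π₁ F‖ ≤ ‖F + ΔF‖` for mean zero `F`. -/
theorem IsWeakLap.norm_sub_proj_le (hn : 2 ≤ n) {F G : Lp ℝ 2 (unif n)} (h : IsWeakLap F G)
    (h0 : ⟪F, linPow n 0 0⟫ = 0) :
    ‖F - (LinearMap.range (linFun n)).starProjection F‖ ≤ ‖F + G‖ := by
  set P := (LinearMap.range (linFun n)).starProjection F with hP
  obtain ⟨a, ha⟩ : P ∈ LinearMap.range (linFun n) := Submodule.starProjection_apply_mem _ _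
  rw [linFun_eq] at ha
  -- Degree 0 is killed by the mean-zero assumption, since linear functions also have mean zero;
  -- degree 1 is killed by the projection.
  have hperp : F - P ∈ (polyLT n 2)ᗮ := by
    rw [Submodule.mem_orthogonal']
    intro p hp
    induction hp using Submodule.span_induction with
    | mem p hp =>
      obtain ⟨b, j, hj, rfl⟩ := hp
      interval_cases j
      · rw [inner_sub_left, linPow_zero b 0, h0, ← ha, inner_linPow_one_zero hn, sub_zero]
      · rw [← linFun_eq]
        exact Submodule.starProjection_inner_eq_zero F _ (LinearMap.mem_range_self _ b)
    | zero => simp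
    | add x y _ _ hx hy => rw [inner_add_right, hx, hy, add_zero]
    | smul c x _ hx => rw [inner_smul_right, hx, mul_zero]
  refine norm_le_of_increment_le fun k => ?_
  rcases Nat.lt_or_ge k 2 with hk | hk
  · rw [increment_eq_zero hk hperp, norm_zero]
    exact norm_nonneg _
  · have hPm : P ∈ polyLT n 2 := ha ▸ linPow_mem_polyLT a one_lt_two
    have e : increment k (F + G) = (1 - eigval n k) • increment k F := by
      rw [map_add, h.increment_eq hn, sub_smul, one_smul, neg_smul, sub_eq_add_neg]
    rw [map_sub, increment_eq_zero_of_mem hk hPm, sub_zero, e, norm_smul, Real.norm_eq_abs]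
    have := two_le_eigval hn hk
    -- An eigenvalue at least 2 gives `|1 - eigval n k| ≥ 1`.
    exact le_mul_of_one_le_left (norm_nonneg _) (by rw [le_abs]; right; linarith)

/-! ### Passing between functions and their `L²` classes -/

section L2

variable {V : Type*} [NormedAddCommGroup V] [InnerProductSpace ℝ V]

theorem inner_toLp_toLp {f g : Sph n → V} (hf : MemLp f 2 (unif n)) (hg : MemLp g 2 (unif n)) :
    ⟪hf.toLp f, hg.toLp g⟫ = ∫ x, ⟪f x, g x⟫ ∂(unif n) := by
  rw [L2.inner_def]
  refine integral_congr_ae ?_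
  filter_upwards [hf.coeFn_toLp, hg.coeFn_toLp] with x h1 h2
  rw [h1, h2]

theorem norm_toLp_sq {f : Sph n → V} (hf : MemLp f 2 (unif n)) :
    ‖hf.toLp f‖ ^ 2 = ∫ x, ‖f x‖ ^ 2 ∂(unif n) := by
  rw [← real_inner_self_eq_norm_sq, inner_toLp_toLp]
  simp

theorem norm_toLp_sq_real {f : Sph n → ℝ} (hf : MemLp f 2 (unif n)) :
    ‖hf.toLp f‖ ^ 2 = ∫ x, f x ^ 2 ∂(unif n) := by
  rw [norm_toLp_sq]; simp

theorem integrable_norm_sq {V : Type*} [NormedAddCommGroup V] {f : Sph n → V}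
    (hf : MemLp f 2 (unif n)) : Integrable (fun x => ‖f x‖ ^ 2) (unif n) :=
  hf.integrable_norm_pow two_ne_zero

theorem memLp_of_continuous {V : Type*} [NormedAddCommGroup V] {f : Sph n → V}
    (hf : Continuous f) : MemLp f 2 (unif n) :=
  hf.memLp_of_hasCompactSupport (HasCompactSupport.of_compactSpace f)

theorem continuousMap_toLp_eq {f : Sph n → ℝ} (hf : Continuous f) (h : MemLp f 2 (unif n)) :
    ContinuousMap.toLp (E := ℝ) 2 (unif n) ℝ ⟨f, hf⟩ = h.toLp f :=
  Lp.ext ((ContinuousMap.coeFn_toLp (unif n) _).trans h.coeFn_toLp.symm)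

theorem tendsto_toLp_clm {V W : Type*} [NormedAddCommGroup V] [NormedSpace ℝ V]
    [NormedAddCommGroup W] [NormedSpace ℝ W] (L : V →L[ℝ] W) {u : ℕ → Sph n → V} {v : Sph n → V}
    (hu : ∀ j, MemLp (u j) 2 (unif n)) (hv : MemLp v 2 (unif n))
    (h : Filter.Tendsto (fun j => (hu j).toLp (u j)) Filter.atTop (nhds (hv.toLp v))) :
    Filter.Tendsto (fun j => (L.comp_memLp' (hu j)).toLp (L ∘ u j)) Filter.atTop
      (nhds ((L.comp_memLp' hv).toLp (L ∘ v))) := by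
  have key : ∀ {w : Sph n → V} (hw : MemLp w 2 (unif n)),
      (L.comp_memLp' hw).toLp (L ∘ w) = L.compLpL 2 (unif n) (hw.toLp w) := by
    intro w hw
    refine Lp.ext ?_
    filter_upwards [(L.comp_memLp' hw).coeFn_toLp, L.coeFn_compLpL (hw.toLp w), hw.coeFn_toLp]
      with x h1 h2 h3
    rw [h1, h2, h3]
    rfl
  rw [key hv]
  exact (((L.compLpL 2 (unif n)).continuous.tendsto _).comp h).congr fun j => (key (hu j)).symm

end L2

/-! ### The inequalities for `C⁴` and `H²` functions -/

theorem poincare_of_isWeakLap (hn : 2 ≤ n) {f g : Sph n → ℝ} (hf : MemLp f 2 (unif n))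
    (hg : MemLp g 2 (unif n)) (h : IsWeakLap (hf.toLp f) (hg.toLp g))
    (h0 : ∫ x, f x ∂(unif n) = 0) :
    MemLp (fun x => f x + g x) 2 (unif n) ∧ MemLp (fun x => f x - proj1 f x) 2 (unif n) ∧
      ∫ x, g x ^ 2 ∂(unif n) + ∫ x, f x * g x ∂(unif n) ≥
        (1 / 2) * ∫ x, (f x + g x) ^ 2 ∂(unif n) ∧
      (1 / 2) * ∫ x, (f x + g x) ^ 2 ∂(unif n) ≥
        (1 / 2) * ∫ x, (f x - proj1 f x) ^ 2 ∂(unif n) := by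
  have hp : proj1 f = ((LinearMap.range (linFun n)).starProjection (hf.toLp f) :
      Lp ℝ 2 (unif n)) := dif_pos hf
  have hpm : MemLp (proj1 f) 2 (unif n) := by rw [hp]; exact Lp.memLp _
  have hfg : MemLp (fun x => f x + g x) 2 (unif n) := hf.add hg
  have hfp : MemLp (fun x => f x - proj1 f x) 2 (unif n) := hf.sub hpm
  have e1 : hfg.toLp _ = hf.toLp f + hg.toLp g := MemLp.toLp_add hf hg
  have e2 : hfp.toLp _ = hf.toLp f -
      (LinearMap.range (linFun n)).starProjection (hf.toLp f) := by
    rw [show hfp.toLp _ = hf.toLp f - hpm.toLp _ from MemLp.toLp_sub hf hpm]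
    congr 1
    refine Lp.ext (hpm.coeFn_toLp.trans ?_)
    rw [hp]
  have hmean : ⟪hf.toLp f, linPow n 0 0⟫ = 0 := by
    have h1 : MemLp (fun x : Sph n => ⟪(0 : Amb n), (x : Amb n)⟫ ^ 0) 2 (unif n) :=
      memLp_of_continuous (by fun_prop)
    rw [linPow, continuousMap_toLp_eq _ h1, inner_toLp_toLp]
    simpa using h0
  have n1 := h.norm_le hn hmean
  have n2 := h.norm_sub_proj_le hn hmean
  have n1' := pow_le_pow_left₀ (norm_nonneg _) n1 2
  have n2' := pow_le_pow_left₀ (norm_nonneg _) n2 2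
  have n3 := norm_add_sq_real (hf.toLp f) (hg.toLp g)
  have n4 : ⟪hf.toLp f, hg.toLp g⟫ = ∫ x, f x * g x ∂(unif n) := by
    rw [inner_toLp_toLp]; simp [mul_comm]
  rw [← e1, ← e2] at n2'
  rw [← e1, n4] at n3
  simp only [norm_toLp_sq_real] at n1' n2' n3
  refine ⟨hfg, hfp, ?_, ?_⟩
  -- By the expansion of `‖f + g‖²`, the gap between the two sides is `(‖g‖² - ‖f‖²) / 2`.
  · linarith
  · linarith

theorem hessian_inequality_of_isCk (hn : 2 ≤ n) (f : Sph n → ℝ) (hf : IsCk 4 f)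
    (h0 : ∫ x, f x ∂(unif n) = 0) :
    Integrable (fun x => Gam 2 f f x - Gam 1 f f x) (unif n) ∧
      Integrable (fun x => hsSq (hess f x)) (unif n) ∧
      MemLp (fun x => f x + lap f x) 2 (unif n) ∧
      MemLp (fun x => f x - proj1 f x) 2 (unif n) ∧
      ∫ x, (Gam 2 f f x - Gam 1 f f x) ∂(unif n) = ∫ x, hsSq (hess f x) ∂(unif n) ∧
      ∫ x, hsSq (hess f x) ∂(unif n) ≥ (1 / 2) * ∫ x, (f x + lap f x) ^ 2 ∂(unif n) ∧
      (1 / 2) * ∫ x, (f x + lap f x) ^ 2 ∂(unif n) ≥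
        (1 / 2) * ∫ x, (f x - proj1 f x) ^ 2 ∂(unif n) := by
  have hf4 : IsCk (4 : ℕ) f := hf
  have hf2 : IsCk (2 : ℕ) f := hf4.of_le (by norm_num)
  have hf3 : IsCk (3 : ℕ) f := hf4.of_le (by norm_num)
  have cL := (IsCk.lap (k := 0) hn hf2).continuous
  have m1 := memLp_of_continuous hf2.continuous
  have m2 := memLp_of_continuous cL
  have hw := isWeakLap_lap hn hf2
  rw [continuousMap_toLp_eq _ m1, continuousMap_toLp_eq _ m2] at hw
  obtain ⟨p1, p2, p3, p4⟩ := poincare_of_isWeakLap hn m1 m2 hw h0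
  obtain ⟨g1, g2⟩ := integrable_gamma_sub hn hf4
  have hH := integral_hsSq_hess hn hf3
  refine ⟨g1, integrable_of_continuous (continuous_hsSq.comp
    (continuous_hess hn le_rfl (hf2.isHom hn one_le_two))), p1, p2, g2.trans hH.symm, ?_, p4⟩
  rwa [hH]

/-- The trace as a continuous linear map. -/
noncomputable def trL (n : ℕ) : (Amb n →L[ℝ] Amb n) →L[ℝ] ℝ :=
  LinearMap.toContinuousLinearMap
    (LinearMap.trace ℝ (Amb n) ∘ₗ ContinuousLinearMap.coeLM ℝ)

/-- Expresses the Hessian energy by finitely many `L²` norms of continuous linear images of `H`, so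
that it passes to the limit along `L²` convergence. -/
theorem integral_hsSq_eq_sum {H : Sph n → Amb n →L[ℝ] Amb n} (hH : MemLp H 2 (unif n)) :
    Integrable (fun x => hsSq (H x)) (unif n) ∧ ∫ x, hsSq (H x) ∂(unif n) =
      ∑ i, ‖((ContinuousLinearMap.apply ℝ (Amb n)
        (EuclideanSpace.single i (1 : ℝ))).comp_memLp' hH).toLp _‖ ^ 2 := by
  have hi := fun i : Fin (n + 1) => integrable_norm_sq ((ContinuousLinearMap.apply ℝ (Amb n)
    (EuclideanSpace.single i (1 : ℝ))).comp_memLp' hH)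
  refine ⟨integrable_finsetSum _ fun i _ => hi i, ?_⟩
  simp only [norm_toLp_sq]
  exact integral_finsetSum _ fun i _ => hi i

theorem hessian_inequality_of_isH2 (hn : 2 ≤ n) (f : Sph n → ℝ) (X : Sph n → Amb n)
    (H : Sph n → Amb n →L[ℝ] Amb n) (h : IsH2 f X H) (h0 : ∫ x, f x ∂(unif n) = 0) :
    Integrable (fun x => tr (H x) ^ 2 - ‖X x‖ ^ 2) (unif n) ∧
      Integrable (fun x => hsSq (H x)) (unif n) ∧
      MemLp (fun x => f x + tr (H x)) 2 (unif n) ∧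
      MemLp (fun x => f x - proj1 f x) 2 (unif n) ∧
      ∫ x, (tr (H x) ^ 2 - ‖X x‖ ^ 2) ∂(unif n) = ∫ x, hsSq (H x) ∂(unif n) ∧
      ∫ x, hsSq (H x) ∂(unif n) ≥ (1 / 2) * ∫ x, (f x + tr (H x)) ^ 2 ∂(unif n) ∧
      (1 / 2) * ∫ x, (f x + tr (H x)) ^ 2 ∂(unif n) ≥
        (1 / 2) * ∫ x, (f x - proj1 f x) ^ 2 ∂(unif n) := by
  obtain ⟨mf, mX, mH, u, hu, tf, tX, tH⟩ := h
  have hu3 : ∀ j, IsCk (3 : ℕ) (u j) := fun j =>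
    (hu j).of_le (WithTop.coe_le_coe.2 (le_top : (3 : ℕ∞) ≤ ⊤))
  have hu2 : ∀ j, IsCk (2 : ℕ) (u j) := fun j => (hu3 j).of_le (by norm_num)
  have hhom := fun j => (hu2 j).isHom hn one_le_two
  have mu := fun j => memLp_of_continuous (hu2 j).continuous
  have mg := fun j => memLp_of_continuous (continuous_grad hn one_le_two (hhom j))
  have mh := fun j => memLp_of_continuous (continuous_hess hn le_rfl (hhom j))
  have tf' := (Lp.tendsto_Lp_iff_tendsto_eLpNorm'' u mu f mf).2 tf
  have tX' := (Lp.tendsto_Lp_iff_tendsto_eLpNorm'' (fun j => grad (u j)) mg X mX).2 tX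
  have tH' := (Lp.tendsto_Lp_iff_tendsto_eLpNorm'' (fun j => hess (u j)) mh H mH).2 tH
  have mT : MemLp (fun x => tr (H x)) 2 (unif n) := (trL n).comp_memLp' mH
  have mL : ∀ j, MemLp (lap (u j)) 2 (unif n) := fun j => (trL n).comp_memLp' (mh j)
  have tT : Filter.Tendsto (fun j => (mL j).toLp (lap (u j))) Filter.atTop
      (nhds (mT.toLp fun x => tr (H x))) := tendsto_toLp_clm (trL n) mh mH tH'
  -- The test functions are fixed, so both sides of the weak identity for `u j` converge under `L²`
  -- convergence of `u j` and of the traces.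
  have hw : IsWeakLap (mf.toLp f) (mT.toLp fun x => tr (H x)) := by
    intro a i
    refine tendsto_nhds_unique (tT.inner tendsto_const_nhds) ?_
    refine (tf'.inner tendsto_const_nhds).congr fun j => ?_
    have := isWeakLap_lap hn (hu2 j) a i
    rw [continuousMap_toLp_eq _ (mu j), continuousMap_toLp_eq _ (mL j)] at this
    exact this.symm
  have hin : ∀ {f g : Sph n → ℝ} (hf : MemLp f 2 (unif n)) (hg : MemLp g 2 (unif n)),
      ⟪hf.toLp f, hg.toLp g⟫ = ∫ x, f x * g x ∂(unif n) := fun hf hg => by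
    rw [inner_toLp_toLp]; simp [mul_comm]
  have hX : ‖mX.toLp X‖ ^ 2 = -⟪mf.toLp f, mT.toLp fun x => tr (H x)⟫ := by
    refine tendsto_nhds_unique (tX'.norm.pow 2) ((tf'.inner tT).neg.congr fun j => ?_)
    rw [norm_toLp_sq, integral_norm_grad_sq hn (hu2 j), hin]
  -- The integrated Bochner formula for `u j`, in the limit.
  have hHS : ∫ x, hsSq (H x) ∂(unif n) = ‖mT.toLp fun x => tr (H x)‖ ^ 2 +
      ⟪mf.toLp f, mT.toLp fun x => tr (H x)⟫ := by
    rw [(integral_hsSq_eq_sum mH).2]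
    refine tendsto_nhds_unique (tendsto_finsetSum _ fun i _ =>
      (tendsto_toLp_clm _ mh mH tH').norm.pow 2)
      (((tT.norm.pow 2).add (tf'.inner tT)).congr fun j => ?_)
    rw [← (integral_hsSq_eq_sum (mh j)).2, integral_hsSq_hess hn (hu3 j), hin,
      norm_toLp_sq_real]
  obtain ⟨p1, p2, p3, p4⟩ := poincare_of_isWeakLap hn mf mT hw h0
  have iT : Integrable (fun x => tr (H x) ^ 2) (unif n) := mT.integrable_sq
  have iX := integrable_norm_sq mX
  refine ⟨iT.sub iX, (integral_hsSq_eq_sum mH).1, p1, p2, ?_, ?_, p4⟩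
  · rw [integral_sub iT iX, hHS, ← norm_toLp_sq mX, hX, norm_toLp_sq_real]
    ring
  · rwa [hHS, norm_toLp_sq_real, hin]

end SpherePoincare

theorem mainTheorem7 (n : ℕ) (hn : 2 ≤ n) :
    (∀ f : Sph n → ℝ, IsCk 4 f → ∫ x, f x ∂(unif n) = 0 →
      Integrable (fun x => Gam 2 f f x - Gam 1 f f x) (unif n) ∧
      Integrable (fun x => hsSq (hess f x)) (unif n) ∧
      MemLp (fun x => f x + lap f x) 2 (unif n) ∧
      MemLp (fun x => f x - proj1 f x) 2 (unif n) ∧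
      ∫ x, (Gam 2 f f x - Gam 1 f f x) ∂(unif n) = ∫ x, hsSq (hess f x) ∂(unif n) ∧
      ∫ x, hsSq (hess f x) ∂(unif n) ≥ (1 / 2) * ∫ x, (f x + lap f x) ^ 2 ∂(unif n) ∧
      (1 / 2) * ∫ x, (f x + lap f x) ^ 2 ∂(unif n) ≥
        (1 / 2) * ∫ x, (f x - proj1 f x) ^ 2 ∂(unif n)) ∧
    (∀ (f : Sph n → ℝ) (X : Sph n → Amb n) (H : Sph n → Amb n →L[ℝ] Amb n),
      IsH2 f X H → ∫ x, f x ∂(unif n) = 0 →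
      Integrable (fun x => tr (H x) ^ 2 - ‖X x‖ ^ 2) (unif n) ∧
      Integrable (fun x => hsSq (H x)) (unif n) ∧
      MemLp (fun x => f x + tr (H x)) 2 (unif n) ∧
      MemLp (fun x => f x - proj1 f x) 2 (unif n) ∧
      ∫ x, (tr (H x) ^ 2 - ‖X x‖ ^ 2) ∂(unif n) = ∫ x, hsSq (H x) ∂(unif n) ∧
      ∫ x, hsSq (H x) ∂(unif n) ≥ (1 / 2) * ∫ x, (f x + tr (H x)) ^ 2 ∂(unif n) ∧
      (1 / 2) * ∫ x, (f x + tr (H x)) ^ 2 ∂(unif n) ≥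
        (1 / 2) * ∫ x, (f x - proj1 f x) ^ 2 ∂(unif n)) :=
  ⟨hessian_inequality_of_isCk hn, hessian_inequality_of_isH2 hn⟩
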